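/- **Conventions.** All pregraphs are finite. A pregraph is a multigraph in which loops and semi-edges are allowed; in degrees a loop counts twice and a semi-edge once. A quotient of $C_4$ is one of: $q_1$, the 4-cycle; $q_2$, the digon (two vertices joined by two edges); $q_3$, an edge with one semi-edge at each of its two vertices; $q_4$, one vertex with two semi-edges. A $C_4^q$-factor is a 2-factor each of whose components is a quotient of $C_4$. A *$C_4^q$-marked pregraph* is a connected (nonempty) cubic pregraph in which the edges of a given $C_4^q$-factor have colour 0 and all other edges colour 1. A *partial* $C_4^q$-marked pregraph is a not necessarily connected pregraph, all of whose vertices have degree 2 or 3, coloured in the same way; its vertices of degree 2 are called deficient. The marked quotients are the components of the colour-0 factor. Isomorphisms preserve colours. **Blocks.** The blocks of a partial $C_4^q$-marked pregraph $P$ are the subgraphs induced by the vertex sets of the following kinds: (1) inclusion-maximal vertex sets of ladders ($K_2\square P_m$, $m\ge 2$, where $P_m$ is the path on $m$ vertices) in $P$ whose marked quotients are all of type $q_1$ (and are contained in the ladder); (2), (3) inclusion-maximal unions of marked quotients of type $q_2$, respectively $q_3$, that induce a connected subgraph; (4) single marked quotients of type $q_4$. They form the block partition of $P$, and $B(P)$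 is the list of blocks, up to order and isomorphism. A block, on its own, is a partial $C_4^q$-marked pregraph that is the only part of its block partition; its deficient vertices are its missing connections. A list $L$ of blocks is *acceptable* if the sequence of the numbers of missing connections of its blocks is the degree sequence of a connected loopless multigraph, at most half of all missing connections lie in $q_2$ blocks, and at most half lie in $q_3$ blocks. **Algorithm.** Connecting two deficient vertices means adding an edge of colour 1 between them. While $L$ is under consideration, a partial $C_4^q$-marked pregraph obtained by adding connections is *valid* if its block list is still $L$ and each of its connected components either contains a deficient vertex or is the whole graph. On input $n$: 1. Generate all acceptable block lists with sum of orders $n$, each once (up to order and isomorphism of the blocks). 2. For each such list $L$ let $P$ be the disjoint union of its blocks, and apply recursively: - (a) If $P$ has no deficient vertices, output $P$ and return. - (b) Compute $\mathrm{Aut}(P)$ and its orbits on the deficient vertices. - (c) If $\mathrm{Aut}(P)$ fixes each deficient vertex, add the remaining connections in all possible valid ways and output each resulting pregraph without deficient vertices once. - (d) Otherwise choose an orbit $O$ of deficient vertices of smallest size, and consider all valid ways of connecting all vertices of $O$ to deficient vertices (every new connection having an end in $O$); take one representative of each isomorphism class of the resulting partial $C_4^q$-marked pregraphs and apply the procedure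 to each of these. The choices left open (vertex names, ties between smallest orbits, representatives in (d) and the method used to find them, e.g. canonical construction paths, order of the lists) are arbitrary. **Theorem.** For every $n$ and for all these choices, the algorithm terminates, and it outputs exactly one representative of every isomorphism class of $C_4^q$-marked pregraphs with $n$ vertices: an output exists, every output pregraph is a $C_4^q$-marked pregraph on $n$ vertices, and every $C_4^q$-marked pregraph on $n$ vertices is isomorphic to exactly one entry of the output list. -/

import Mathlib

/-- A pregraph with vertex set `V` (a multigraph in which loops and semi-edges are allowed), given by
multiplicities: `edge s(u, v)` is the number of edges between `u` and `v` (the number of loops at `u`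
if `u = v`), and `semi v` is the number of semi-edges at `v`. -/
@[ext]
structure Pregraph (V : Type*) where
  edge : Sym2 V → ℕ
  semi : V → ℕ

namespace Pregraph

variable {V W : Type*}

/-- Pull-back along a map of vertices; along an inclusion `S ↪ V` it is the sub-pregraph induced
by `S`. -/
def comap (f : W → V) (G : Pregraph V) : Pregraph W where
  edge e := G.edge (e.map f)
  semi w := G.semi (f w)

def induce (G : Pregraph V) (S : Set V) : Pregraph S := G.comap Subtype.val

def Iso (G : Pregraph V) (H : Pregraph W) : Prop := ∃ σ : V ≃ W, H.comap σ = G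

/-- The degree; a loop counts twice, a semi-edge counts once. -/
def deg [Fintype V] (G : Pregraph V) (v : V) : ℕ :=
  (∑ u, G.edge s(v, u)) + G.edge s(v, v) + G.semi v

/-- The underlying simple graph (it carries adjacency and connectivity). -/
def toSimple (G : Pregraph V) : SimpleGraph V where
  Adj u v := u ≠ v ∧ 0 < G.edge s(u, v)
  symm := ⟨fun u v h => ⟨h.1.symm, by rw [Sym2.eq_swap]; exact h.2⟩⟩
  loopless := ⟨fun _ h => h.1 rfl⟩

/-- Nonempty, and any two vertices are joined by a path. -/
def Connected (G : Pregraph V) : Prop := G.toSimple.Connected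

/-- The vertex set of the connected component of `v`. -/
def component (G : Pregraph V) (v : V) : Set V := {w | G.toSimple.Reachable v w}

def Cubic [Fintype V] (G : Pregraph V) : Prop := ∀ v, G.deg v = 3

/-- The quotient `q₁`: the 4-cycle. -/
def q1 : Pregraph (Fin 4) where
  edge e := if e = s(0, 1) ∨ e = s(1, 2) ∨ e = s(2, 3) ∨ e = s(3, 0) then 1 else 0
  semi _ := 0

/-- The quotient `q₂`: the digon. -/
def q2 : Pregraph (Fin 2) where
  edge e := if e = s(0, 1) then 2 else 0
  semi _ := 0

/-- The quotient `q₃`: an edge with a semi-edge at each of its two vertices. -/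
def q3 : Pregraph (Fin 2) where
  edge e := if e = s(0, 1) then 1 else 0
  semi _ := 1

/-- The quotient `q₄`: a vertex with two semi-edges. -/
def q4 : Pregraph (Fin 1) where
  edge _ := 0
  semi _ := 2

/-- The component of `v` is isomorphic to `q`. -/
def CompType (G : Pregraph V) (q : Pregraph W) (v : V) : Prop := (G.induce (G.component v)).Iso q

/-- `F` is 2-regular and each of its components is a quotient of `C₄`. -/
def IsC4QuotientFactor [Fintype V] (F : Pregraph V) : Prop :=
  (∀ v, F.deg v = 2) ∧
    ∀ v, F.CompType q1 v ∨ F.CompType q2 v ∨ F.CompType q3 v ∨ F.CompType q4 v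

end Pregraph

/-- A pregraph whose edges (and semi-edges) are coloured with the colours 0 and 1: `zero` consists of
the edges of colour 0 (the marked ones), `one` of those of colour 1. -/
@[ext]
structure Marked (V : Type*) where
  zero : Pregraph V
  one : Pregraph V

namespace Marked

variable {V W : Type*}

/-- The underlying uncoloured pregraph. -/
def under (P : Marked V) : Pregraph V where
  edge e := P.zero.edge e + P.one.edge e
  semi v := P.zero.semi v + P.one.semi v

def comap (f : W → V) (P : Marked V) : Marked W where
  zero := P.zero.comap f
  one := P.one.comap f

def induce (P : Marked V) (S : Set V) : Marked S := P.comap Subtype.val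

/-- `σ` is a colour-preserving isomorphism. -/
def IsIso (σ : V ≃ W) (P : Marked V) (Q : Marked W) : Prop := Q.comap σ = P

def Iso (P : Marked V) (Q : Marked W) : Prop := ∃ σ : V ≃ W, IsIso σ P Q

/-- A `C₄`-quotient-marked pregraph: a connected cubic pregraph in which the edges of a factor
consisting of quotients of `C₄` have colour 0 and all other edges have colour 1. -/
def IsC4Marked [Fintype V] (P : Marked V) : Prop :=
  P.under.Connected ∧ P.under.Cubic ∧ P.zero.IsC4QuotientFactor

/-- A partial `C₄`-quotient-marked pregraph: not necessarily connected, all degrees are 2 or 3. -/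
def IsPartial [Fintype V] (P : Marked V) : Prop :=
  (∀ v, P.under.deg v = 2 ∨ P.under.deg v = 3) ∧ P.zero.IsC4QuotientFactor

def Deficient [Fintype V] (P : Marked V) (v : V) : Prop := P.under.deg v = 2

/-- The automorphism group, acting on the vertices. -/
def aut (P : Marked V) : Subgroup (Equiv.Perm V) where
  carrier := {σ | IsIso σ P P}
  mul_mem' := by
    intro σ τ hσ hτ
    have h : (P.comap σ).comap τ = P := by
      rw [show P.comap σ = P from hσ]; exact hτ
    have h' : (P.comap σ).comap τ = P.comap (σ * τ : Equiv.Perm V) := by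
      simp [comap, Pregraph.comap, Sym2.map_map]
    exact h'.symm.trans h
  one_mem' := by simp [IsIso, comap, Pregraph.comap]
  inv_mem' := by
    intro σ hσ
    have h : (P.comap σ).comap (σ⁻¹ : Equiv.Perm V) = P := by
      simp [comap, Pregraph.comap, Sym2.map_map]
    rw [show P.comap σ = P from hσ] at h
    exact h

/-! ### Block partition -/

/-- The ladder with `m` rungs. -/
def ladderGraph (m : ℕ) : SimpleGraph (Fin 2 × Fin m) :=
  (⊤ : SimpleGraph (Fin 2)) □ SimpleGraph.pathGraph m

/-- `S` is the vertex set of a ladder in `P` containing only marked quotients of type `q₁`: the marked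
quotients of its vertices have type `q₁` and their edges are edges of the ladder. -/
def IsQ1Ladder (P : Marked V) (S : Set V) : Prop :=
  ∃ m, 2 ≤ m ∧ ∃ f : Fin 2 × Fin m → V, Function.Injective f ∧ Set.range f = S ∧
    (∀ a b, (ladderGraph m).Adj a b → 0 < P.under.edge s(f a, f b)) ∧
    (∀ a, P.zero.CompType Pregraph.q1 (f a)) ∧
    ∀ a w, 0 < P.zero.edge s(f a, w) → ∃ b, f b = w ∧ (ladderGraph m).Adj a b

/-- `S` induces a connected subgraph of `P` and is a union of marked quotients isomorphic to `q`. -/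
def IsConnectedUnion (P : Marked V) (q : Pregraph W) (S : Set V) : Prop :=
  (P.under.induce S).Connected ∧
    ∀ v ∈ S, P.zero.CompType q v ∧ P.zero.component v ⊆ S

/-- `S` is the vertex set of a block of `P`. The block itself is the subgraph induced by `S`. -/
def IsBlockSet (P : Marked V) (S : Set V) : Prop :=
  Maximal (P.IsQ1Ladder) S ∨
  Maximal (P.IsConnectedUnion Pregraph.q2) S ∨
  Maximal (P.IsConnectedUnion Pregraph.q3) S ∨
  ∃ v, P.zero.CompType Pregraph.q4 v ∧ S = P.zero.component v

/-- The parts of the block partition of `P`. -/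
def blockPartition (P : Marked V) : Set (Set V) := {S | P.IsBlockSet S}

end Marked

/-! ### Block lists -/

/-- A finite marked pregraph, as an entry of a list. -/
structure FinMarked where
  order : ℕ
  graph : Marked (Fin order)

namespace FinMarked

/-- A block: a partial marked pregraph that is the only part of its block partition. -/
def IsBlock (b : FinMarked) : Prop := b.graph.IsPartial ∧ b.graph.IsBlockSet Set.univ

/-- The number of deficient vertices. -/
noncomputable def numDeficient (b : FinMarked) : ℕ := {v | b.graph.Deficient v}.ncard

/-- All marked quotients are isomorphic to `q`. -/
def OfType {W : Type*} (b : FinMarked) (q : Pregraph W) : Prop :=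
  ∀ v, b.graph.zero.CompType q v

end FinMarked

/-- A list of finite marked pregraphs; as block lists, two of these are regarded as the same if they
are equivalent in the sense of `BlockList.Equiv`. -/
abbrev BlockList := List FinMarked

namespace BlockList

/-- Equality of block lists up to reordering and isomorphism of the blocks. -/
def Equiv (L L' : BlockList) : Prop :=
  ∃ e : Fin L.length ≃ Fin L'.length, ∀ i, (L.get i).graph.Iso (L'.get (e i)).graph

/-- The sum of the orders of the blocks. -/
def order (L : BlockList) : ℕ := (L.map FinMarked.order).sum

/-- The degree sequence of `L` (the numbers of missing connections of the blocks) is realised by a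
connected multigraph without loops. -/
def Multigraphic (L : BlockList) : Prop :=
  ∃ G : Pregraph (Fin L.length), G.Connected ∧ (∀ i, G.edge s(i, i) = 0) ∧ (∀ i, G.semi i = 0) ∧
    ∀ i, G.deg i = (L.get i).numDeficient

/-- The number of missing connections. -/
noncomputable def missing (L : BlockList) : ℕ := (L.map FinMarked.numDeficient).sum

open Classical in
/-- The number of missing connections that lie in blocks whose marked quotients have type `q`. -/
noncomputable def missingIn {W : Type*} (L : BlockList) (q : Pregraph W) : ℕ :=
  ((L.filter fun b => b.OfType q).map FinMarked.numDeficient).sum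

structure Acceptable (L : BlockList) : Prop where
  isBlock : ∀ b ∈ L, b.IsBlock
  multigraphic : L.Multigraphic
  half_q2 : 2 * L.missingIn Pregraph.q2 ≤ L.missing
  half_q3 : 2 * L.missingIn Pregraph.q3 ≤ L.missing

end BlockList

namespace Marked

variable {V : Type*}

/-- The partial marked pregraph `P` has block list `L`. -/
def HasBlockList [Fintype V] (P : Marked V) (L : BlockList) : Prop :=
  P.IsPartial ∧ ∃ e : Fin L.length ≃ P.blockPartition,
    ∀ i, (L.get i).graph.Iso (P.induce (e i : Set V))

/-- `P` is the partial marked pregraph that corresponds to `L` without connections, i.e. (up to the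
names of the vertices, given by `φ`) the disjoint union of the entries of `L`. -/
def IsInitial (P : Marked V) (L : BlockList) : Prop :=
  ∃ φ : (Σ i : Fin L.length, Fin (L.get i).order) ≃ V,
    (∀ i, P.comap (fun x => φ ⟨i, x⟩) = (L.get i).graph) ∧
    ∀ a b, a.1 ≠ b.1 → P.under.edge s(φ a, φ b) = 0

/-! ### Connections -/

open Classical in
/-- `P` with an additional edge of colour 1 for each of the pairs in `M`. -/
noncomputable def connect (P : Marked V) (M : Set (Sym2 V)) : Marked V where
  zero := P.zero
  one :=
    { edge := fun e => P.one.edge e + if e ∈ M then 1 else 0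
      semi := P.one.semi }

/-- `M` consists of pairwise disjoint pairs of distinct deficient vertices of `P`. -/
def IsConnectionSet [Fintype V] (P : Marked V) (M : Set (Sym2 V)) : Prop :=
  (∀ e ∈ M, ¬ e.IsDiag ∧ ∀ v ∈ e, P.Deficient v) ∧
    ∀ e ∈ M, ∀ e' ∈ M, ∀ v, v ∈ e → v ∈ e' → e = e'

/-- No new block has arisen, and no component other than the whole graph is without deficient
vertices. -/
def Valid [Fintype V] (L : BlockList) (P : Marked V) : Prop :=
  P.HasBlockList L ∧
    ∀ v, P.under.component v = Set.univ ∨ ∃ w ∈ P.under.component v, P.Deficient w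

/-- `Q` arises from `P` by adding all remaining connections in a valid way. -/
def IsCompletion [Fintype V] (L : BlockList) (P Q : Marked V) : Prop :=
  ∃ M, P.IsConnectionSet M ∧ (∀ v, P.Deficient v → ∃ e ∈ M, v ∈ e) ∧ Q = P.connect M ∧ Q.Valid L

/-- `Q` arises from `P` by connecting all vertices of `O` to deficient vertices in a valid way. -/
def IsOrbitConnection [Fintype V] (L : BlockList) (O : Set V) (P Q : Marked V) : Prop :=
  ∃ M, P.IsConnectionSet M ∧ (∀ e ∈ M, ∃ v ∈ O, v ∈ e) ∧ (∀ v ∈ O, ∃ e ∈ M, v ∈ e) ∧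
    Q = P.connect M ∧ Q.Valid L

/-- `O` is an orbit of deficient vertices of smallest size. -/
def IsSmallestOrbit [Fintype V] (P : Marked V) (O : Set V) : Prop :=
  (∃ v, P.Deficient v ∧ O = MulAction.orbit P.aut v) ∧
    ∀ w, P.Deficient w → O.ncard ≤ (MulAction.orbit P.aut w).ncard

/-- The automorphism group fixes each deficient vertex. -/
def AutTrivialOnDeficient [Fintype V] (P : Marked V) : Prop :=
  ∀ σ ∈ P.aut, ∀ v, P.Deficient v → σ v = v

/-! ### The algorithm -/

/-- `Children L P R`: the list `R` is a possible result of the branching step at `P`. A smallest orbit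
`O` is chosen, and `R` contains exactly one representative of each isomorphism class of the partial
marked pregraphs obtained by connecting `O` in a valid way. -/
def Children [Fintype V] (L : BlockList) (P : Marked V) (R : List (Marked V)) : Prop :=
  ∃ O, P.IsSmallestOrbit O ∧ (∀ Q ∈ R, IsOrbitConnection L O P Q) ∧
    R.Pairwise (fun Q Q' => ¬ Q.Iso Q') ∧
    ∀ Q, IsOrbitConnection L O P Q → ∃ Q' ∈ R, Q.Iso Q'

/-- `Recurse L P out`: the recursive procedure, called with `P` while the block list `L` is under
consideration, may output the list `out`. -/
inductive Recurse [Fintype V] (L : BlockList) : Marked V → List (Marked V) → Prop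
  | done (P : Marked V) (h : ∀ v, ¬ P.Deficient v) : Recurse L P [P]
  | complete (P : Marked V) (h : ∃ v, P.Deficient v) (ht : P.AutTrivialOnDeficient)
      (out : List (Marked V)) (hd : out.Nodup) (ho : ∀ Q, Q ∈ out ↔ IsCompletion L P Q) :
      Recurse L P out
  | branch (P : Marked V) (ht : ¬ P.AutTrivialOnDeficient)
      (R : List (Marked V)) (hR : Children L P R)
      (out : Marked V → List (Marked V)) (ho : ∀ Q ∈ R, Recurse L Q (out Q)) :
      Recurse L P (R.flatMap out)

/-- `Q` may be one of the arguments of the recursive calls made by the call with argument `P`. -/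
def Calls [Fintype V] (L : BlockList) (Q P : Marked V) : Prop :=
  ¬ P.AutTrivialOnDeficient ∧ ∃ R, Children L P R ∧ Q ∈ R

end Marked

/-- `lists` contains exactly one representative of each acceptable block list of order `n`. -/
def GeneratesBlockLists (n : ℕ) (lists : List BlockList) : Prop :=
  (∀ L ∈ lists, L.Acceptable ∧ L.order = n) ∧
    lists.Pairwise (fun L L' => ¬ L.Equiv L') ∧
    ∀ L : BlockList, L.Acceptable → L.order = n → ∃ L' ∈ lists, L.Equiv L'

/-- `Generates n out`: the algorithm with input `n` may output the list `out`. -/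
def Generates (n : ℕ) (out : List (Marked (Fin n))) : Prop :=
  ∃ lists, GeneratesBlockLists n lists ∧
    ∃ (start : BlockList → Marked (Fin n)) (res : BlockList → List (Marked (Fin n))),
      (∀ L ∈ lists, (start L).IsInitial L ∧ Marked.Recurse L (start L) (res L)) ∧
      out = lists.flatMap res

/-! The central object is `cut Q`: the marked pregraph `Q` without its colour-1 edges between
different blocks. It makes sense because the blocks of a partial marked pregraph really partition
the vertices (`IsPartial.existsUnique_block`). The delicate case is that of ladders: as degrees are
at most 3, a maximal ladder meeting another ladder can only be left through an end rung, and then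
the next marked 4-cycle could be appended, contradicting maximality
(`LadderLabelling.subset_of_maximal`).

The cut is canonical: it commutes with isomorphisms (`cut_comap`), and every marked pregraph between
`cut Q` and `Q` has the block partition of `Q` (`blockPartition_eq_of_cut_le`). The disjoint union
of the blocks in the list of `Q` is isomorphic to `cut Q` (`IsInitial.iso_cut`), and equal to it if
`Q` arises from that union by adding connections (`IsInitial.eq_cut`).

No repetition: isomorphic outputs have equivalent block lists, hence come from the same list. An
isomorphism between them preserves the cuts, so it is an automorphism of the common starting graph.
It stays one along the recursion: an automorphism of `P` preserves the chosen orbit `O`, and a child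
of `P` is recovered from any of its outputs by taking the output's edges at `O` and the edges of `P`
elsewhere. So the two children are isomorphic, hence equal, and the map is an automorphism of the
child. When automorphisms fix all deficient vertices, they fix all added edges, so the outputs
coincide (`Recurse.pairwise`).

No omission: the block list of a connected cubic `Q` is acceptable (`HasBlockList.acceptable`), and
`cut Q` is the start up to isomorphism. While `cut Q ≤ P ≤ Q`, the missing edges at `O` give a valid
way of connecting `O`; replacing `Q` by an isomorphic copy moves to the chosen representative and
preserves the two inequalities (`Recurse.exists_iso`).

Termination: each recursive call has fewer deficient vertices. -/

namespace Pregraph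

/-! ### Pull-backs, components and the types of marked quotients -/

variable {V W U : Type*}

theorem comap_comap (f : W → V) (g : U → W) (G : Pregraph V) :
    (G.comap f).comap g = G.comap (f ∘ g) := by
  simp [comap, Sym2.map_map]

@[simp] theorem comap_id (G : Pregraph V) : G.comap id = G := by simp [comap]

/-- The edges at vertices of the range of `f` do not leave the range of `f`. -/
def ClosedRange (f : W → V) (G : Pregraph V) : Prop :=
  ∀ w v, 0 < G.edge s(f w, v) → v ∈ Set.range f

theorem ClosedRange.of_surjective {f : W → V} (hf : Function.Surjective f) (G : Pregraph V) :
    ClosedRange f G := fun _ v _ => hf v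

theorem deg_comap [Fintype V] [Fintype W] {G : Pregraph V} {f : W → V}
    (hf : Function.Injective f) (hc : ClosedRange f G) (w : W) :
    (G.comap f).deg w = G.deg (f w) := by
  unfold deg
  congr 2
  apply Fintype.sum_of_injective f hf
  · intro v hv
    by_contra h
    exact hv (hc w v (Nat.pos_of_ne_zero h))
  · intro u; rfl

theorem deg_comap_le [Fintype V] [Fintype W] {G : Pregraph V} {f : W → V}
    (hf : Function.Injective f) (w : W) : (G.comap f).deg w ≤ G.deg (f w) := by
  classical
  unfold deg
  gcongr
  · calc ∑ u, (G.comap f).edge s(w, u) = ∑ u ∈ Finset.univ.map ⟨f, hf⟩, G.edge s(f w, u) := by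
          rw [Finset.sum_map]; rfl
      _ ≤ _ := Finset.sum_le_sum_of_subset (Finset.subset_univ _)
  · exact le_rfl
  · exact le_rfl

theorem deg_comap_equiv [Fintype V] [Fintype W] (G : Pregraph V) (σ : W ≃ V) (w : W) :
    (G.comap σ).deg w = G.deg (σ w) :=
  deg_comap σ.injective (.of_surjective σ.surjective G) w

theorem toSimple_comap (G : Pregraph V) {f : W → V} (hf : Function.Injective f) :
    (G.comap f).toSimple = G.toSimple.comap f := by
  ext a b
  simp [toSimple, comap, hf.eq_iff]

theorem mem_component_self (G : Pregraph V) (v : V) : v ∈ G.component v :=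
  SimpleGraph.Reachable.refl v

theorem component_eq {G : Pregraph V} {v w : V} (h : w ∈ G.component v) :
    G.component w = G.component v := by
  ext x
  exact ⟨fun hx => SimpleGraph.Reachable.trans h hx,
    fun hx => SimpleGraph.Reachable.trans (SimpleGraph.Reachable.symm h) hx⟩

theorem mem_component_of_edge {G : Pregraph V} {u v : V} (h : 0 < G.edge s(u, v)) :
    v ∈ G.component u := by
  by_cases huv : u = v
  · subst huv; exact G.mem_component_self u
  · exact SimpleGraph.Adj.reachable (G := G.toSimple) ⟨huv, h⟩

theorem mem_component_of_edge_right {G : Pregraph V} {u v w : V} (hu : u ∈ G.component w)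
    (h : 0 < G.edge s(u, v)) : v ∈ G.component w := by
  rw [← component_eq hu]; exact mem_component_of_edge h

/-- A set that is closed under adjacency contains the components of its elements. -/
theorem component_subset {G : Pregraph V} {S : Set V} {v : V} (hv : v ∈ S)
    (hS : ∀ u ∈ S, ∀ w, 0 < G.edge s(u, w) → w ∈ S) : G.component v ⊆ S := by
  intro w hw
  have h := (SimpleGraph.reachable_iff_reflTransGen v w).1 hw
  clear hw
  induction h with
  | refl => exact hv
  | tail _ h ih => exact hS _ ih _ h.2

/-- Closedness of the range keeps every walk from `f w` inside the range, so walks can be pushed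
forward and lifted back. -/
theorem image_component {G : Pregraph V} {f : W → V} (hc : ClosedRange f G) (w : W) :
    f '' (G.comap f).component w = G.component (f w) := by
  apply Set.Subset.antisymm
  · rw [Set.image_subset_iff]
    apply component_subset (G := G.comap f) (S := f ⁻¹' G.component (f w))
      (G.mem_component_self (f w))
    intro u hu x hx
    exact mem_component_of_edge_right (G := G) hu hx
  · apply component_subset (Set.mem_image_of_mem f (mem_component_self _ w))
    rintro _ ⟨u, hu, rfl⟩ x hx
    obtain ⟨y, rfl⟩ := hc _ _ hx
    exact ⟨y, mem_component_of_edge_right hu hx, rfl⟩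

theorem Iso.symm {G : Pregraph V} {H : Pregraph W} (h : G.Iso H) : H.Iso G := by
  obtain ⟨σ, rfl⟩ := h
  exact ⟨σ.symm, by rw [comap_comap]; simp⟩

theorem Iso.trans {G : Pregraph V} {H : Pregraph W} {K : Pregraph U} (h : G.Iso H)
    (h' : H.Iso K) : G.Iso K := by
  obtain ⟨σ, rfl⟩ := h
  obtain ⟨τ, rfl⟩ := h'
  exact ⟨σ.trans τ, by rw [comap_comap]; rfl⟩

theorem induce_comap_iso (G : Pregraph V) {f : W → V} (hf : Function.Injective f) (S : Set W) :
    ((G.comap f).induce S).Iso (G.induce (f '' S)) := by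
  refine ⟨Equiv.Set.image f S hf, ?_⟩
  simp only [induce, comap_comap]
  rfl

theorem compType_comap {G : Pregraph V} {f : W → V} (hf : Function.Injective f)
    (hc : ClosedRange f G) (q : Pregraph U) (w : W) :
    (G.comap f).CompType q w ↔ G.CompType q (f w) := by
  have h := G.induce_comap_iso hf ((G.comap f).component w)
  rw [image_component hc] at h
  exact ⟨fun h' => h.symm.trans h', fun h' => h.trans h'⟩

theorem CompType.of_mem {G : Pregraph V} {q : Pregraph U} {v w : V} (h : G.CompType q v)
    (hw : w ∈ G.component v) : G.CompType q w := by
  unfold CompType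
  rw [component_eq hw]; exact h

theorem IsC4QuotientFactor.comap [Fintype V] [Fintype W] {G : Pregraph V} {f : W → V}
    (hf : Function.Injective f) (hc : ClosedRange f G) (h : G.IsC4QuotientFactor) :
    (G.comap f).IsC4QuotientFactor := by
  refine ⟨fun w => by rw [deg_comap hf hc]; exact h.1 _, fun w => ?_⟩
  simp only [compType_comap hf hc]
  exact h.2 _

/-- The four quotients of `C₄`: vertex `v` lies in a component of `G` isomorphic to the quotient
with index `t`. -/
def HasType (G : Pregraph V) : Fin 4 → V → Prop
  | 0 => G.CompType q1
  | 1 => G.CompType q2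
  | 2 => G.CompType q3
  | 3 => G.CompType q4

theorem IsC4QuotientFactor.exists_hasType [Fintype V] {G : Pregraph V}
    (h : G.IsC4QuotientFactor) (v : V) : ∃ t, G.HasType t v := by
  rcases h.2 v with h | h | h | h
  exacts [⟨0, h⟩, ⟨1, h⟩, ⟨2, h⟩, ⟨3, h⟩]

theorem CompType.ncard {G : Pregraph V} {q : Pregraph U} {v : V} (h : G.CompType q v) :
    (G.component v).ncard = Nat.card U := by
  obtain ⟨σ, -⟩ := h
  exact Nat.card_congr σ

theorem CompType.semi_eq {G : Pregraph V} {q : Pregraph U} {v : V} (h : G.CompType q v) :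
    ∃ u, G.semi v = q.semi u := by
  obtain ⟨σ, hσ⟩ := h
  refine ⟨σ ⟨v, G.mem_component_self v⟩, ?_⟩
  exact (congrFun (congrArg Pregraph.semi hσ) ⟨v, G.mem_component_self v⟩).symm

theorem HasType.ncard {G : Pregraph V} {t : Fin 4} {v : V} (h : G.HasType t v) :
    (G.component v).ncard = ![4, 2, 2, 1] t := by
  fin_cases t <;> simpa using CompType.ncard h

theorem HasType.semi {G : Pregraph V} {t : Fin 4} {v : V} (h : G.HasType t v) :
    G.semi v = ![0, 0, 1, 2] t := by
  fin_cases t <;> · obtain ⟨u, hu⟩ := CompType.semi_eq h; exact hu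

/-- The order of the component and the number of semi-edges at a vertex, (4,0), (2,0), (2,1) and
(1,2), tell the four quotients apart. -/
theorem HasType.unique {G : Pregraph V} {t t' : Fin 4} {v : V} (h : G.HasType t v)
    (h' : G.HasType t' v) : t = t' := by
  have h1 := h.ncard.symm.trans h'.ncard
  have h2 := h.semi.symm.trans h'.semi
  revert h1 h2 t t'
  intro t t' _ _
  fin_cases t <;> fin_cases t' <;> simp

end Pregraph

/-! ### Marked pregraphs and the sets whose maximal members are the blocks -/

namespace Marked

variable {V W U : Type*}

theorem comap_comap (f : W → V) (g : U → W) (P : Marked V) :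
    (P.comap f).comap g = P.comap (f ∘ g) := by
  simp [comap, Pregraph.comap_comap]

@[simp] theorem comap_id (P : Marked V) : P.comap id = P := by simp [comap]

theorem IsIso.symm {σ : V ≃ W} {P : Marked V} {Q : Marked W} (h : IsIso σ P Q) :
    IsIso σ.symm Q P := by
  unfold IsIso at *
  rw [← h, comap_comap]; simp

theorem IsIso.trans {σ : V ≃ W} {τ : W ≃ U} {P : Marked V} {Q : Marked W} {R : Marked U}
    (h : IsIso σ P Q) (h' : IsIso τ Q R) : IsIso (σ.trans τ) P R := by
  unfold IsIso at *
  rw [← h, ← h', comap_comap]; rfl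

theorem Iso.refl (P : Marked V) : P.Iso P := ⟨Equiv.refl V, comap_id P⟩

theorem Iso.symm {P : Marked V} {Q : Marked W} (h : P.Iso Q) : Q.Iso P := by
  obtain ⟨σ, h⟩ := h; exact ⟨σ.symm, h.symm⟩

theorem Iso.trans {P : Marked V} {Q : Marked W} {R : Marked U} (h : P.Iso Q) (h' : Q.Iso R) :
    P.Iso R := by
  obtain ⟨σ, h⟩ := h; obtain ⟨τ, h'⟩ := h'; exact ⟨σ.trans τ, h.trans h'⟩

theorem under_comap (P : Marked V) (f : W → V) : (P.comap f).under = P.under.comap f := rfl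

theorem deg_under [Fintype V] (P : Marked V) (v : V) :
    P.under.deg v = P.zero.deg v + P.one.deg v := by
  simp only [Pregraph.deg, under, Finset.sum_add_distrib]; ring

/-- Colour 0 contributes exactly 2 to every degree, so all degree conditions become conditions on
colour 1. This is the form used throughout. -/
theorem isPartial_iff [Fintype V] {P : Marked V} :
    P.IsPartial ↔ (∀ v, P.one.deg v ≤ 1) ∧ P.zero.IsC4QuotientFactor := by
  unfold IsPartial
  refine and_congr_left fun h => forall_congr' fun v => ?_
  rw [deg_under, h.1]; omega

theorem isC4Marked_iff [Fintype V] {P : Marked V} : P.IsC4Marked ↔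
    P.under.Connected ∧ (∀ v, P.one.deg v = 1) ∧ P.zero.IsC4QuotientFactor := by
  unfold IsC4Marked
  refine and_congr_right fun _ => and_congr_left fun h => forall_congr' fun v => ?_
  rw [deg_under, h.1]; omega

theorem deficient_iff [Fintype V] {P : Marked V} (h : P.zero.IsC4QuotientFactor) (v : V) :
    P.Deficient v ↔ P.one.deg v = 0 := by
  unfold Deficient
  rw [deg_under, h.1]; omega

/-- Only colour-0 edges must stay inside the range: losing colour-1 edges merely makes vertices
deficient. -/
theorem IsPartial.comap [Fintype V] [Fintype W] {P : Marked V} (h : P.IsPartial) {f : W → V}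
    (hf : Function.Injective f) (hc : Pregraph.ClosedRange f P.zero) : (P.comap f).IsPartial := by
  rw [isPartial_iff] at *
  exact ⟨fun w => (Pregraph.deg_comap_le hf w).trans (h.1 _), h.2.comap hf hc⟩

/-- The vertex sets of which the blocks of the four kinds are the inclusion-maximal ones. -/
def IsPreblock (P : Marked V) : Fin 4 → Set V → Prop
  | 0 => P.IsQ1Ladder
  | 1 => P.IsConnectedUnion Pregraph.q2
  | 2 => P.IsConnectedUnion Pregraph.q3
  | 3 => fun S => ∃ v, P.zero.CompType Pregraph.q4 v ∧ S = P.zero.component v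

theorem IsPreblock.hasType {P : Marked V} {t : Fin 4} {S : Set V} (h : P.IsPreblock t S) {v : V}
    (hv : v ∈ S) : P.zero.HasType t v := by
  fin_cases t
  · obtain ⟨m, _, f, _, rfl, _, h, _⟩ := h
    obtain ⟨a, rfl⟩ := hv
    exact h a
  · exact (h.2 v hv).1
  · exact (h.2 v hv).1
  · obtain ⟨w, h, rfl⟩ := h
    exact h.of_mem hv

theorem IsPreblock.nonempty {P : Marked V} {t : Fin 4} {S : Set V} (h : P.IsPreblock t S) :
    S.Nonempty := by
  fin_cases t
  · obtain ⟨m, hm, f, _, rfl, _⟩ := h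
    exact ⟨_, (0, ⟨0, by omega⟩), rfl⟩
  · obtain ⟨v⟩ := h.1.nonempty; exact ⟨v, v.2⟩
  · obtain ⟨v⟩ := h.1.nonempty; exact ⟨v, v.2⟩
  · obtain ⟨w, h, rfl⟩ := h
    exact ⟨w, Pregraph.mem_component_self _ _⟩

theorem IsPreblock.mem_of_edge {P : Marked V} {t : Fin 4} {S : Set V} (h : P.IsPreblock t S)
    {u v : V} (hu : u ∈ S) (huv : 0 < P.zero.edge s(u, v)) : v ∈ S := by
  fin_cases t
  · obtain ⟨m, hm, f, _, rfl, _, _, h⟩ := h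
    obtain ⟨a, rfl⟩ := hu
    obtain ⟨b, rfl, _⟩ := h a v huv
    exact ⟨b, rfl⟩
  · exact (h.2 u hu).2 (Pregraph.mem_component_of_edge huv)
  · exact (h.2 u hu).2 (Pregraph.mem_component_of_edge huv)
  · obtain ⟨w, h, rfl⟩ := h
    exact Pregraph.mem_component_of_edge_right hu huv

theorem IsPreblock.component_subset {P : Marked V} {t : Fin 4} {S : Set V} (h : P.IsPreblock t S)
    {v : V} (hv : v ∈ S) : P.zero.component v ⊆ S :=
  Pregraph.component_subset hv fun _ hu _ => h.mem_of_edge hu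

/-- Components of type `q₄` are maximal automatically, since nested components coincide; this makes
the four kinds of blocks uniform. -/
theorem isBlockSet_iff {P : Marked V} {S : Set V} :
    P.IsBlockSet S ↔ ∃ t, Maximal (P.IsPreblock t) S := by
  constructor
  · rintro (h | h | h | h)
    · exact ⟨0, h⟩
    · exact ⟨1, h⟩
    · exact ⟨2, h⟩
    · refine ⟨3, h, ?_⟩
      obtain ⟨v, hv, rfl⟩ := h
      rintro _ ⟨w, hw, rfl⟩ hvw
      rw [Pregraph.component_eq (hvw (Pregraph.mem_component_self _ _))]
  · rintro ⟨t, h⟩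
    fin_cases t
    exacts [.inl h, .inr (.inl h), .inr (.inr (.inl h)), .inr (.inr (.inr h.prop))]

/-- Whether `S` is a preblock depends only on the edges of colour 0 and those inside `S`. -/
theorem IsPreblock.of_le_on {P Q : Marked V} {t : Fin 4} {S : Set V} (h : P.IsPreblock t S)
    (hz : P.zero = Q.zero)
    (he : ∀ u ∈ S, ∀ v ∈ S, 0 < P.under.edge s(u, v) → 0 < Q.under.edge s(u, v)) :
    Q.IsPreblock t S := by
  have key : (P.under.induce S).Connected → (Q.under.induce S).Connected := by
    intro h
    refine SimpleGraph.Connected.mono ?_ h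
    intro a b hab
    exact ⟨hab.1, he _ a.2 _ b.2 hab.2⟩
  fin_cases t
  · obtain ⟨m, hm, f, hf, rfl, h1, h2, h3⟩ := h
    rw [hz] at h2 h3
    exact ⟨m, hm, f, hf, rfl, fun a b hab => he _ ⟨a, rfl⟩ _ ⟨b, rfl⟩ (h1 a b hab), h2, h3⟩
  · exact ⟨key h.1, by rw [← hz]; exact h.2⟩
  · exact ⟨key h.1, by rw [← hz]; exact h.2⟩
  · obtain ⟨v, hv⟩ := h
    rw [hz] at hv
    exact ⟨v, hv⟩

theorem connected_induce_comap {P : Pregraph V} {f : W → V} (hf : Function.Injective f)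
    (S : Set W) : ((P.comap f).induce S).Connected ↔ (P.induce (f '' S)).Connected := by
  unfold Pregraph.Connected
  obtain ⟨σ, hσ⟩ := P.induce_comap_iso hf S
  rw [← hσ, Pregraph.toSimple_comap _ σ.injective]
  exact SimpleGraph.Iso.connected_iff (SimpleGraph.Iso.comap σ _)

theorem isConnectedUnion_comap {P : Marked V} {f : W → V} (hf : Function.Injective f)
    (hc : Pregraph.ClosedRange f P.zero) (q : Pregraph U) (S : Set W) :
    (P.comap f).IsConnectedUnion q S ↔ P.IsConnectedUnion q (f '' S) := by
  refine and_congr (connected_induce_comap (P := P.under) hf S) ?_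
  rw [Set.forall_mem_image]
  refine forall₂_congr fun w _ => and_congr (Pregraph.compType_comap hf hc q w) ?_
  rw [← Pregraph.image_component hc, Set.image_subset_image_iff hf]
  rfl

theorem isPreblock_comap {P : Marked V} {f : W → V} (hf : Function.Injective f)
    (hc : Pregraph.ClosedRange f P.zero) (t : Fin 4) (S : Set W) :
    (P.comap f).IsPreblock t S ↔ P.IsPreblock t (f '' S) := by
  fin_cases t
  · constructor
    · rintro ⟨m, hm, g, hg, rfl, h1, h2, h3⟩
      refine ⟨m, hm, f ∘ g, hf.comp hg, Set.range_comp f g, h1,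
        fun a => (Pregraph.compType_comap hf hc _ _).1 (h2 a), ?_⟩
      intro a v hv
      obtain ⟨w, rfl⟩ := hc _ _ hv
      obtain ⟨b, rfl, hab⟩ := h3 a w hv
      exact ⟨b, rfl, hab⟩
    · rintro ⟨m, hm, g, hg, hr, h1, h2, h3⟩
      have hg' : ∀ a, ∃ w, f w = g a := fun a => by
        have : g a ∈ f '' S := hr ▸ ⟨a, rfl⟩
        obtain ⟨w, _, h⟩ := this
        exact ⟨w, h⟩
      choose g' hg' using hg'
      obtain rfl : f ∘ g' = g := funext hg'
      refine ⟨m, hm, g', hg.of_comp, ?_, h1,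
        fun a => (Pregraph.compType_comap hf hc _ _).2 (h2 a), ?_⟩
      · rw [Set.range_comp] at hr
        exact hf.image_injective hr
      · intro a w hw
        obtain ⟨b, hb, hab⟩ := h3 a (f w) hw
        exact ⟨b, hf hb, hab⟩
  · exact isConnectedUnion_comap hf hc _ S
  · exact isConnectedUnion_comap hf hc _ S
  · constructor
    · rintro ⟨w, hw, rfl⟩
      exact ⟨f w, (Pregraph.compType_comap hf hc _ _).1 hw, Pregraph.image_component hc w⟩
    · rintro ⟨v, hv, h⟩
      obtain ⟨w, hw, rfl⟩ : v ∈ f '' S := h ▸ Pregraph.mem_component_self _ _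
      refine ⟨w, (Pregraph.compType_comap hf hc _ _).2 hv, ?_⟩
      rw [← Pregraph.image_component hc] at h
      exact hf.image_injective h

end Marked

/-! ### Marked 4-cycles and ladders -/

namespace Pregraph

variable {V W : Type*}

theorem q1_edge_pos (i j : Fin 4) : 0 < q1.edge s(i, j) ↔ j = i + 1 ∨ i = j + 1 := by
  revert i j; unfold q1; decide

theorem edge_symm_of_comap_eq {G : Pregraph V} {H : Pregraph W} {S : Set V} {σ : S ≃ W}
    (hσ : H.comap σ = G.induce S) (i j : W) :
    G.edge s((σ.symm i : V), σ.symm j) = H.edge s(i, j) := by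
  have h : (G.induce S).edge s(σ.symm i, σ.symm j) = H.edge s(σ (σ.symm i), σ (σ.symm j)) := by
    rw [← hσ]; rfl
  rwa [σ.apply_symm_apply, σ.apply_symm_apply] at h

theorem CompType.exists_edge {G : Pregraph V} {a : V} (h : G.CompType q1 a) :
    ∃ b, 0 < G.edge s(a, b) := by
  obtain ⟨σ, hσ⟩ := h
  obtain ⟨i, hi⟩ : ∃ i, (σ.symm i : V) = a := ⟨σ ⟨a, G.mem_component_self a⟩, by simp⟩
  refine ⟨σ.symm (i + 1), ?_⟩
  nth_rw 1 [← hi]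
  rw [edge_symm_of_comap_eq hσ, q1_edge_pos]
  exact .inl rfl

/-- The labelling of a component of type `q₁` may start with any of its edges. -/
theorem CompType.exists_square {G : Pregraph V} {a b : V} (h : G.CompType q1 a)
    (hab : 0 < G.edge s(a, b)) : ∃ g : Fin 4 → V, Function.Injective g ∧
      Set.range g = G.component a ∧ g 0 = a ∧ g 1 = b ∧
      ∀ i j, 0 < G.edge s(g i, g j) ↔ j = i + 1 ∨ i = j + 1 := by
  obtain ⟨σ, hσ⟩ := h
  have he : ∀ i j, 0 < G.edge s((σ.symm i : V), σ.symm j) ↔ j = i + 1 ∨ i = j + 1 := by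
    intro i j
    rw [edge_symm_of_comap_eq hσ, q1_edge_pos]
  have hr : ∀ τ : Equiv.Perm (Fin 4),
      Set.range (fun i => (σ.symm (τ i) : V)) = G.component a := by
    intro τ
    rw [show (fun i => (σ.symm (τ i) : V)) = Subtype.val ∘ (τ.trans σ.symm) from rfl,
      Set.range_comp, Equiv.range_eq_univ, Set.image_univ, Subtype.range_val]
  have hi : ∀ τ : Equiv.Perm (Fin 4), Function.Injective (fun i => (σ.symm (τ i) : V)) :=
    fun τ => Subtype.val_injective.comp (σ.symm.injective.comp τ.injective)
  obtain ⟨i, hi'⟩ : ∃ i, (σ.symm i : V) = a := ⟨σ ⟨a, G.mem_component_self a⟩, by simp⟩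
  obtain ⟨j, hj'⟩ : ∃ j, (σ.symm j : V) = b := ⟨σ ⟨b, mem_component_of_edge hab⟩, by simp⟩
  have hij := (he i j).1 (by rw [hi', hj']; exact hab)
  rcases hij with rfl | rfl
  -- The cycle runs from `a` to `b` in increasing direction: rotate the labels.
  · refine ⟨_, hi (Equiv.addLeft i), hr _, by simpa using hi', by simpa using hj', fun k l => ?_⟩
    rw [he]
    simp [add_assoc]
  -- It runs in decreasing direction: use the reflection `k ↦ j + 1 - k`, which starts at `a` and
  -- goes on to `b`.
  · refine ⟨_, hi (Equiv.subLeft (j + 1)), hr _, by simpa using hi', by simpa using hj',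
      fun k l => ?_⟩
    rw [he]
    simp only [Equiv.subLeft_apply]
    clear * -
    revert j k l; decide

theorem card_le_deg [Fintype V] (G : Pregraph V) (v : V) (s : Finset V)
    (hs : ∀ u ∈ s, 0 < G.edge s(v, u)) : s.card ≤ G.deg v := by
  unfold deg
  calc s.card = ∑ u ∈ s, 1 := by simp
    _ ≤ ∑ u ∈ s, G.edge s(v, u) := Finset.sum_le_sum hs
    _ ≤ ∑ u, G.edge s(v, u) := Finset.sum_le_sum_of_subset (Finset.subset_univ _)
    _ ≤ _ := by omega

end Pregraph

namespace Marked

variable {V W : Type*}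

theorem ladderGraph_adj {m : ℕ} (a b : Fin 2 × Fin m) : (ladderGraph m).Adj a b ↔
    (a.1 ≠ b.1 ∧ a.2 = b.2) ∨
      (a.1 = b.1 ∧ ((a.2 : ℕ) + 1 = b.2 ∨ (b.2 : ℕ) + 1 = a.2)) := by
  simp only [ladderGraph, SimpleGraph.boxProd_adj, SimpleGraph.top_adj,
    SimpleGraph.pathGraph_adj]
  tauto

/-- `F i j`, for `i : Fin 2` and `j < m`, are the vertices of a ladder with `m` rungs in `P` that
contains only marked quotients of type `q₁`. -/
structure LadderLabelling (P : Marked V) (m : ℕ) (F : Fin 2 → ℕ → V) : Prop where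
  inj : ∀ i i' j j', j < m → j' < m → F i j = F i' j' → i = i' ∧ j = j'
  rung : ∀ j, j < m → 0 < P.under.edge s(F 0 j, F 1 j)
  rail : ∀ i j, j + 1 < m → 0 < P.under.edge s(F i j, F i (j + 1))
  type : ∀ i j, j < m → P.zero.CompType Pregraph.q1 (F i j)
  zero : ∀ i j w, j < m → 0 < P.zero.edge s(F i j, w) →
    w = F (i + 1) j ∨ (j + 1 < m ∧ w = F i (j + 1)) ∨ (0 < j ∧ w = F i (j - 1))

/-- The vertex set of a labelled ladder. -/
def ladderSet (m : ℕ) (F : Fin 2 → ℕ → V) : Set V := {v | ∃ i, ∃ j < m, F i j = v}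

theorem fin_two_ne {i j : Fin 2} : i ≠ j ↔ j = i + 1 := by revert i j; decide

/-- Indexing the rungs by natural numbers, with arbitrary values from `m` on, turns reversing and
concatenating ladders into plain arithmetic. -/
theorem isQ1Ladder_iff {P : Marked V} {S : Set V} :
    P.IsQ1Ladder S ↔ ∃ m, 2 ≤ m ∧ ∃ F, P.LadderLabelling m F ∧ ladderSet m F = S := by
  constructor
  · rintro ⟨m, hm, f, hf, rfl, h1, h2, h3⟩
    have : NeZero m := ⟨by omega⟩
    have hF : ∀ i j (h : j < m), f (i, Fin.ofNat m j) = f (i, ⟨j, h⟩) := by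
      intro i j h
      congr 2
      exact Fin.ext (Nat.mod_eq_of_lt h)
    refine ⟨m, hm, fun i j => f (i, Fin.ofNat m j), ⟨?_, ?_, ?_, ?_, ?_⟩, ?_⟩
    · intro i i' j j' hj hj' h
      rw [hF _ _ hj, hF _ _ hj'] at h
      simpa using hf h
    · intro j hj
      rw [hF _ _ hj, hF _ _ hj]
      exact h1 _ _ ((ladderGraph_adj _ _).2 (.inl (by simp)))
    · intro i j hj
      rw [hF _ _ hj, hF i j (by omega)]
      exact h1 _ _ ((ladderGraph_adj _ _).2 (.inr (by simp)))
    · intro i j hj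
      exact h2 _
    · intro i j w hj hw
      rw [hF _ _ hj] at hw ⊢
      obtain ⟨⟨k, l⟩, rfl, hkl⟩ := h3 _ _ hw
      rw [ladderGraph_adj] at hkl
      rcases hkl with ⟨h, h'⟩ | ⟨h, h' | h'⟩
      · left
        simp only at h h'
        rw [fin_two_ne.1 h, h']
      · right; left
        simp only at h h'
        have := l.2
        refine ⟨by omega, ?_⟩
        rw [h, hF _ _ (by omega)]
        congr 2
        exact Fin.ext h'.symm
      · right; right
        simp only at h h'
        refine ⟨by omega, ?_⟩
        rw [h, hF _ _ (by omega)]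
        congr 2
        exact Fin.ext (by simp only; omega)
    · ext v
      constructor
      · rintro ⟨i, j, hj, rfl⟩
        exact ⟨_, rfl⟩
      · rintro ⟨⟨i, j⟩, rfl⟩
        exact ⟨i, j, j.2, hF _ _ j.2⟩
  · rintro ⟨m, hm, F, h, rfl⟩
    refine ⟨m, hm, fun p => F p.1 p.2, ?_, ?_, ?_, ?_, ?_⟩
    · rintro ⟨i, j⟩ ⟨i', j'⟩ hij
      obtain ⟨rfl, h'⟩ := h.inj _ _ _ _ j.2 j'.2 hij
      rw [Fin.ext h']
    · ext v
      constructor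
      · rintro ⟨⟨i, j⟩, rfl⟩
        exact ⟨i, j, j.2, rfl⟩
      · rintro ⟨i, j, hj, rfl⟩
        exact ⟨⟨i, ⟨j, hj⟩⟩, rfl⟩
    · rintro ⟨i, j⟩ ⟨i', j'⟩ hij
      rw [ladderGraph_adj] at hij
      rcases hij with ⟨h1, h2⟩ | ⟨h1, h2 | h2⟩
      · simp only at h1 h2 ⊢
        subst h2
        have := h.rung j j.2
        fin_cases i <;> fin_cases i' <;> first | exact absurd rfl h1 | exact this | skip
        rw [Sym2.eq_swap]; exact this
      · simp only at h1 h2 ⊢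
        subst h1
        rw [← h2]
        exact h.rail _ _ (by omega)
      · simp only at h1 h2 ⊢
        subst h1
        rw [← h2, Sym2.eq_swap]
        exact h.rail _ _ (by omega)
    · rintro ⟨i, j⟩
      exact h.type i j j.2
    · rintro ⟨i, j⟩ w hw
      rcases h.zero _ _ _ j.2 hw with rfl | ⟨hj, rfl⟩ | ⟨hj, rfl⟩
      · exact ⟨⟨i + 1, j⟩, rfl, (ladderGraph_adj _ _).2 (.inl ⟨fin_two_ne.2 rfl, rfl⟩)⟩
      · exact ⟨⟨i, ⟨j + 1, hj⟩⟩, rfl, (ladderGraph_adj _ _).2 (.inr (by simp))⟩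
      · exact ⟨⟨i, ⟨j - 1, by omega⟩⟩, rfl, (ladderGraph_adj _ _).2 (.inr
          ⟨rfl, .inr (by simp only; omega)⟩)⟩

namespace LadderLabelling

variable {P : Marked V} {m k : ℕ} {F G : Fin 2 → ℕ → V}

theorem reverse (h : P.LadderLabelling m F) :
    P.LadderLabelling m (fun i j => F i (m - 1 - j)) := by
  refine ⟨?_, ?_, ?_, ?_, ?_⟩
  · intro i i' j j' hj hj' h'
    have := h.inj _ _ _ _ (by omega) (by omega) h'
    exact ⟨this.1, by omega⟩
  · intro j hj
    exact h.rung _ (by omega)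
  · intro i j hj
    have := h.rail i (m - 1 - (j + 1)) (by omega)
    rw [Sym2.eq_swap]
    rwa [show m - 1 - (j + 1) + 1 = m - 1 - j by omega] at this
  · intro i j hj
    exact h.type _ _ (by omega)
  · intro i j w hj hw
    rcases h.zero _ _ _ (by omega) hw with h' | ⟨hj, h'⟩ | ⟨hj, h'⟩
    · exact .inl h'
    · exact .inr (.inr ⟨by omega, by
        rwa [show m - 1 - j + 1 = m - 1 - (j - 1) by omega] at h'⟩)
    · exact .inr (.inl ⟨by omega, by
        rwa [show m - 1 - j - 1 = m - 1 - (j + 1) by omega] at h'⟩)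

theorem ladderSet_reverse : ladderSet m (fun i j => F i (m - 1 - j)) = ladderSet m F := by
  ext v
  constructor
  · rintro ⟨i, j, hj, rfl⟩
    exact ⟨i, m - 1 - j, by omega, rfl⟩
  · rintro ⟨i, j, hj, rfl⟩
    refine ⟨i, m - 1 - j, by omega, ?_⟩
    simp only
    rw [show m - 1 - (m - 1 - j) = j by omega]

theorem swap (h : P.LadderLabelling m F) : P.LadderLabelling m (fun i j => F (i + 1) j) := by
  refine ⟨?_, ?_, ?_, ?_, ?_⟩
  · intro i i' j j' hj hj' h'
    have := h.inj _ _ _ _ hj hj' h'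
    exact ⟨add_right_cancel this.1, this.2⟩
  · intro j hj
    rw [Sym2.eq_swap]
    exact h.rung j hj
  · intro i j hj
    exact h.rail _ _ hj
  · intro i j hj
    exact h.type _ _ hj
  · intro i j w hj hw
    exact h.zero _ _ _ hj hw

theorem ladderSet_swap : ladderSet m (fun i j => F (i + 1) j) = ladderSet m F := by
  ext v
  constructor
  · rintro ⟨i, j, hj, rfl⟩
    exact ⟨i + 1, j, hj, rfl⟩
  · rintro ⟨i, j, hj, rfl⟩
    refine ⟨i + 1, j, hj, ?_⟩
    simp only
    rw [add_assoc, show (1 + 1 : Fin 2) = 0 from rfl, add_zero]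

/-- Each of the two ladders is closed under colour-0 edges, so gluing needs only the two new rails.
This is how a ladder is shown not to be maximal. -/
theorem append (hF : P.LadderLabelling m F) (hG : P.LadderLabelling k G)
    (hd : Disjoint (ladderSet m F) (ladderSet k G))
    (hc : ∀ i, 0 < P.under.edge s(F i (m - 1), G i 0)) :
    P.LadderLabelling (m + k) (fun i j => if j < m then F i j else G i (j - m)) := by
  have hne : ∀ i j i' j', j < m → j' < k → F i j ≠ G i' j' := by
    intro i j i' j' hj hj' h
    exact Set.disjoint_left.1 hd ⟨i, j, hj, h⟩ ⟨i', j', hj', rfl⟩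
  refine ⟨?_, ?_, ?_, ?_, ?_⟩
  · intro i i' j j' hj hj' h
    split_ifs at h with h1 h2 h2
    · exact hF.inj _ _ _ _ h1 h2 h
    · exact absurd h (hne _ _ _ _ h1 (by omega))
    · exact absurd h.symm (hne _ _ _ _ h2 (by omega))
    · have := hG.inj _ _ _ _ (by omega) (by omega) h
      exact ⟨this.1, by omega⟩
  · intro j hj
    split_ifs with h1
    · exact hF.rung j h1
    · exact hG.rung _ (by omega)
  · intro i j hj
    split_ifs with h1 h2 h2
    · exact hF.rail i j h2
    · rw [show j = m - 1 by omega, show m - 1 + 1 - m = 0 by omega]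
      exact hc i
    · omega
    · rw [show j + 1 - m = j - m + 1 by omega]
      exact hG.rail _ _ (by omega)
  · intro i j hj
    split_ifs with h1
    · exact hF.type _ _ h1
    · exact hG.type _ _ (by omega)
  · intro i j w hj hw
    by_cases h1 : j < m
    · simp only [h1, if_true] at hw ⊢
      rcases hF.zero _ _ _ h1 hw with h' | ⟨hj, h'⟩ | ⟨hj, h'⟩
      · exact .inl h'
      · exact .inr (.inl ⟨by omega, by rw [if_pos hj]; exact h'⟩)
      · exact .inr (.inr ⟨by omega, by rw [if_pos (by omega)]; exact h'⟩)
    · simp only [h1, if_false] at hw ⊢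
      rcases hG.zero _ _ _ (by omega) hw with h' | ⟨hj, h'⟩ | ⟨hj, h'⟩
      · exact .inl h'
      · refine .inr (.inl ⟨by omega, ?_⟩)
        rw [if_neg (by omega), show j + 1 - m = j - m + 1 by omega]; exact h'
      · refine .inr (.inr ⟨by omega, ?_⟩)
        rw [if_neg (by omega), show j - 1 - m = j - m - 1 by omega]; exact h'

theorem ladderSet_append :
    ladderSet (m + k) (fun i j => if j < m then F i j else G i (j - m)) =
      ladderSet m F ∪ ladderSet k G := by
  ext v
  constructor
  · rintro ⟨i, j, hj, rfl⟩
    by_cases h : j < m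
    · exact .inl ⟨i, j, h, by simp [h]⟩
    · exact .inr ⟨i, j - m, by omega, by simp [h]⟩
  · rintro (⟨i, j, hj, rfl⟩ | ⟨i, j, hj, rfl⟩)
    · exact ⟨i, j, by omega, by simp [hj]⟩
    · exact ⟨i, m + j, by omega, by simp⟩

/-- A marked quotient of type `q₁` is a ladder whose first rung may be any of its edges. -/
theorem exists_of_square {a b : V} (h : P.zero.CompType Pregraph.q1 a)
    (hab : 0 < P.zero.edge s(a, b)) :
    ∃ F, P.LadderLabelling 2 F ∧ ladderSet 2 F = P.zero.component a ∧ F 0 0 = a ∧ F 1 0 = b := by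
  obtain ⟨g, hg, hr, rfl, rfl, he⟩ := h.exists_square hab
  have hu : ∀ i j, (j = i + 1 ∨ i = j + 1) → 0 < P.under.edge s(g i, g j) := by
    intro i j hij
    have := (he i j).2 hij
    simp only [under]; omega
  -- The cycle `g 0, g 1, g 2, g 3` is read as the rungs `g 0 – g 1` and `g 3 – g 2`, with rails `g
  -- 0 – g 3` and `g 1 – g 2`.
  have hset : ladderSet 2 ![fun j => ![g 0, g 3] (Fin.ofNat 2 j),
      fun j => ![g 1, g 2] (Fin.ofNat 2 j)] = P.zero.component (g 0) := by
    rw [← hr]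
    ext v
    constructor
    · rintro ⟨i, j, hj, rfl⟩
      interval_cases j <;> fin_cases i <;> exact ⟨_, rfl⟩
    · rintro ⟨i, rfl⟩
      fin_cases i
      exacts [⟨0, 0, by omega, rfl⟩, ⟨1, 0, by omega, rfl⟩, ⟨1, 1, by omega, rfl⟩,
        ⟨0, 1, by omega, rfl⟩]
  refine ⟨_, ⟨?_, ?_, ?_, ?_, ?_⟩, hset, rfl, rfl⟩
  · intro i i' j j' hj hj' h
    interval_cases j <;> interval_cases j' <;> fin_cases i <;> fin_cases i' <;>
      first | exact ⟨rfl, rfl⟩ | (exact absurd (hg h) (by decide))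
  · intro j hj
    interval_cases j
    exacts [hu 0 1 (by decide), hu 3 2 (by decide)]
  · intro i j hj
    obtain rfl : j = 0 := by omega
    fin_cases i
    exacts [hu 0 3 (by decide), hu 1 2 (by decide)]
  · intro i j hj
    refine h.of_mem ?_
    rw [← hset]
    exact ⟨i, j, hj, rfl⟩
  · intro i j w hj hw
    have hw' : w ∈ P.zero.component (g 0) := by
      refine Pregraph.mem_component_of_edge_right ?_ hw
      rw [← hset]
      exact ⟨i, j, hj, rfl⟩
    rw [← hr] at hw'
    obtain ⟨l, rfl⟩ := hw'
    interval_cases j <;> fin_cases i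
    · rcases (he 0 l).1 hw with h | h
      · obtain rfl : l = 1 := by omega
        exact .inl rfl
      · obtain rfl : l = 3 := by omega
        exact .inr (.inl ⟨by omega, rfl⟩)
    · rcases (he 1 l).1 hw with h | h
      · obtain rfl : l = 2 := by omega
        exact .inr (.inl ⟨by omega, rfl⟩)
      · obtain rfl : l = 0 := by omega
        exact .inl rfl
    · rcases (he 3 l).1 hw with h | h
      · obtain rfl : l = 0 := by omega
        exact .inr (.inr ⟨by omega, rfl⟩)
      · obtain rfl : l = 2 := by omega
        exact .inl rfl
    · rcases (he 2 l).1 hw with h | h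
      · obtain rfl : l = 3 := by omega
        exact .inl rfl
      · obtain rfl : l = 1 := by omega
        exact .inr (.inr ⟨by omega, rfl⟩)

/-- The rungs of a ladder containing only marked quotients are marked. -/
theorem rung_zero (h : P.LadderLabelling m F) {j : ℕ} (hj : j < m) :
    0 < P.zero.edge s(F 0 j, F 1 j) := by
  obtain ⟨b, hb⟩ := (h.type 0 j hj).exists_edge
  obtain ⟨g, hg, -, h0, -, he⟩ := (h.type 0 j hj).exists_square hb
  have h1 := (he 0 1).2 (by decide)
  have h3 := (he 0 3).2 (by decide)
  have h12 := (he 1 2).2 (by decide)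
  have h32 := (he 3 2).2 (by decide)
  by_contra hn
  have h02 : F 0 j ≠ g 2 := h0 ▸ hg.ne (by decide)
  have h13 : g 1 ≠ g 3 := hg.ne (by decide)
  rw [h0] at h1 h3
  -- If the rung were unmarked, the marked neighbours of `F 0 j` would be `F 0 (j + 1)` and `F 0 (j
  -- - 1)`. The vertex opposite to `F 0 j` in the 4-cycle would be a marked neighbour of both, but
  -- within the ladder they have no common marked neighbour except `F 0 j`.
  have key : ∀ x y w, 0 < P.zero.edge s(F 0 j, x) → 0 < P.zero.edge s(F 0 j, y) → x ≠ y →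
      0 < P.zero.edge s(x, w) → 0 < P.zero.edge s(y, w) → F 0 j ≠ w →
      (j + 1 < m ∧ x = F 0 (j + 1)) → False := by
    rintro x y w hx hy hxy hxw hyw hw ⟨hj1, rfl⟩
    rcases h.zero _ _ _ hj hy with rfl | ⟨_, rfl⟩ | ⟨hj0, rfl⟩
    · exact hn hy
    · exact hxy rfl
    · rcases h.zero _ _ _ hj1 hxw with rfl | ⟨hj2, rfl⟩ | ⟨_, rfl⟩ <;>
      rcases h.zero _ _ _ (by omega) hyw with h' | ⟨hj3, h'⟩ | ⟨_, h'⟩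
      all_goals first
        | exact hw rfl
        | (have := (h.inj _ _ _ _ (by omega) (by omega) h').2; omega)
  rcases h.zero _ _ _ hj h1 with h' | h' | h'
  · exact hn (h' ▸ h1)
  · exact key _ _ _ h1 h3 h13 h12 h32 h02 h'
  · rcases h.zero _ _ _ hj h3 with h'' | h'' | h''
    · exact hn (h'' ▸ h3)
    · exact key _ _ _ h3 h1 h13.symm h32 h12 h02 h''
    · exact h13 (h'.2.trans h''.2.symm)

theorem under_rung (h : P.LadderLabelling m F) (i : Fin 2) {j : ℕ} (hj : j < m) :
    0 < P.under.edge s(F i j, F (i + 1) j) := by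
  fin_cases i
  · exact h.rung j hj
  · rw [Sym2.eq_swap]; exact h.rung j hj

/-- A vertex of a ladder that has a neighbour outside lies in the first or in the last rung. -/
theorem end_of_outside [Fintype V] (h : P.LadderLabelling m F) {i : Fin 2} {j : ℕ} (hj : j < m)
    (hd : P.under.deg (F i j) ≤ 3) {w : V} (hw : w ∉ ladderSet m F)
    (he : 0 < P.under.edge s(F i j, w)) : j = 0 ∨ j = m - 1 := by
  classical
  by_contra hn
  push Not at hn
  have hj1 : j + 1 < m := by omega
  have hmem : ∀ i j, j < m → F i j ≠ w := fun i j hj h => hw ⟨i, j, hj, h⟩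
  have hrail : 0 < P.under.edge s(F i j, F i (j - 1)) := by
    have := h.rail i (j - 1) (by omega)
    rw [Sym2.eq_swap]
    rwa [show j - 1 + 1 = j by omega] at this
  -- At an inner rung the outside neighbour would be a fourth one, besides those along the rung and
  -- the two rails.
  have hcard : ({w, F (i + 1) j, F i (j + 1), F i (j - 1)} : Finset V).card = 4 := by
    have h1 : ∀ i i' j j', j < m → j' < m → j ≠ j' → F i j ≠ F i' j' :=
      fun i i' j j' hj hj' hne h' => hne (h.inj _ _ _ _ hj hj' h').2
    rw [Finset.card_insert_of_notMem, Finset.card_insert_of_notMem, Finset.card_pair]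
    · exact h1 _ _ _ _ hj1 (by omega) (by omega)
    · simp only [Finset.mem_insert, Finset.mem_singleton, not_or]
      exact ⟨h1 _ _ _ _ hj hj1 (by omega), h1 _ _ _ _ hj (by omega) (by omega)⟩
    · simp only [Finset.mem_insert, Finset.mem_singleton, not_or]
      exact ⟨(hmem _ _ hj).symm, (hmem _ _ hj1).symm, (hmem _ _ (by omega)).symm⟩
  have := Pregraph.card_le_deg P.under (F i j) {w, F (i + 1) j, F i (j + 1), F i (j - 1)} (by
    simp only [Finset.mem_insert, Finset.mem_singleton]
    rintro u (rfl | rfl | rfl | rfl)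
    exacts [he, h.under_rung i hj, h.rail i j hj1, hrail])
  omega

/-- An edge of a ladder both of whose ends have a neighbour outside may be taken as its last
rung. -/
theorem exists_relabel [Fintype V] (h : P.LadderLabelling m F) (hm : 2 ≤ m) (a : Fin 2 → V)
    (ha : ∀ i, a i ∈ ladderSet m F) (hz : 0 < P.zero.edge s(a 0, a 1))
    (hd : ∀ v, P.under.deg v ≤ 3)
    (ho : ∀ i, ∃ w ∉ ladderSet m F, 0 < P.under.edge s(a i, w)) :
    ∃ F', P.LadderLabelling m F' ∧ ladderSet m F' = ladderSet m F ∧ ∀ i, F' i (m - 1) = a i := by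
  obtain ⟨i, j, hj, h0⟩ := ha 0
  obtain ⟨i', j', hj', h1⟩ := ha 1
  obtain ⟨w, hw, he⟩ := ho 0
  obtain ⟨w', hw', he'⟩ := ho 1
  rw [← h0] at he
  rw [← h1] at he'
  have hjm := h.end_of_outside hj (hd _) hw he
  have hjm' := h.end_of_outside hj' (hd _) hw' he'
  -- If the marked edge is a rail, its ends lie in consecutive rungs that are both end rungs. So `m
  -- = 2`, the ladder is a single marked 4-cycle, and it can be relabelled with that edge as a rung.
  have hrails : ∀ j' < m, (j + 1 = j' ∨ j' + 1 = j) → (j' = 0 ∨ j' = m - 1) → ∃ F',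
      P.LadderLabelling m F' ∧ ladderSet m F' = ladderSet m F ∧ ∀ i, F' i (m - 1) = a i := by
    intro j' hj' hjj hjm'
    obtain rfl : m = 2 := by omega
    have ht := h.type i j hj
    rw [h0] at ht
    obtain ⟨G, hG, hset, hG0, hG1⟩ := exists_of_square ht hz
    refine ⟨_, hG.reverse, ?_, ?_⟩
    · rw [ladderSet_reverse, hset]
      have hsub : P.zero.component (a 0) ⊆ ladderSet 2 F :=
        IsPreblock.component_subset (t := 0) (isQ1Ladder_iff.2 ⟨2, le_rfl, F, h, rfl⟩)
          ⟨i, j, hj, h0⟩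
      refine Set.eq_of_subset_of_ncard_le hsub ?_ (Set.toFinite _)
      rw [ht.ncard, Nat.card_fin]
      have : ladderSet 2 F ⊆ Set.range (fun p : Fin 2 × Fin 2 => F p.1 p.2) := by
        rintro v ⟨i, j, hj, rfl⟩
        exact ⟨(i, ⟨j, hj⟩), rfl⟩
      refine (Set.ncard_le_ncard this (Set.toFinite _)).trans ?_
      rw [← Set.image_univ]
      refine (Set.ncard_image_le (Set.toFinite _)).trans ?_
      simp
    · intro i
      fin_cases i
      exacts [hG0, hG1]
  rw [← h0] at hz
  rcases h.zero _ _ _ hj hz with h' | ⟨hj1, h'⟩ | ⟨hj1, h'⟩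
  · obtain ⟨rfl, rfl⟩ := h.inj _ _ _ _ hj' hj (h1.trans h')
    rcases hjm with rfl | rfl
    · fin_cases i
      · refine ⟨_, h.reverse, ladderSet_reverse, fun i => ?_⟩
        fin_cases i
        · simpa using h0
        · simpa using h1
      · refine ⟨_, h.swap.reverse, ladderSet_reverse.trans ladderSet_swap, fun i => ?_⟩
        fin_cases i
        · simpa using h0
        · simpa using h1
    · fin_cases i
      · refine ⟨_, h, rfl, fun i => ?_⟩
        fin_cases i
        exacts [h0, h1]
      · refine ⟨_, h.swap, ladderSet_swap, fun i => ?_⟩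
        fin_cases i
        exacts [h0, h1]
  · obtain ⟨rfl, rfl⟩ := h.inj _ _ _ _ hj' hj1 (h1.trans h')
    exact hrails _ hj1 (.inl rfl) hjm'
  · obtain ⟨rfl, rfl⟩ := h.inj _ _ _ _ hj' (by omega) (h1.trans h')
    exact hrails _ hj' (.inr (by omega)) hjm'

/-- A maximal ladder contains each ladder that it meets. -/
theorem subset_of_maximal [Fintype V] {S : Set V} (hS : Maximal P.IsQ1Ladder S)
    (hd : ∀ v, P.under.deg v ≤ 3) (hG : P.LadderLabelling k G)
    (hne : (S ∩ ladderSet k G).Nonempty) : ladderSet k G ⊆ S := by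
  obtain ⟨m, hm, F, hF, rfl⟩ := isQ1Ladder_iff.1 hS.prop
  have hpre : P.IsPreblock 0 (ladderSet m F) := hS.prop
  -- Rungs are marked edges, so the maximal ladder contains both ends of a rung of `G` or neither.
  have hrung : ∀ i j, j < k → (G i j ∈ ladderSet m F ↔ G 0 j ∈ ladderSet m F) := by
    intro i j hj
    have hz := hG.rung_zero hj
    fin_cases i
    · exact Iff.rfl
    · exact ⟨fun h => hpre.mem_of_edge h (by rwa [Sym2.eq_swap]), fun h => hpre.mem_of_edge h hz⟩
  -- If rung `j` lies in the maximal ladder and the neighbouring rung `j'` does not, rung `j` has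
  -- outside neighbours at both ends. Make it the last rung and append the marked 4-cycle `B` of
  -- rung `j'`: a larger ladder.
  have hstep : ∀ j j', j < k → j' < k → (∀ i, 0 < P.under.edge s(G i j, G i j')) →
      G 0 j ∈ ladderSet m F → G 0 j' ∈ ladderSet m F := by
    intro j j' hj hj' he hjS
    by_contra hn
    have hout : ∀ i, G i j' ∉ ladderSet m F := fun i h => hn ((hrung i j' hj').1 h)
    obtain ⟨F', hF', hFset, hlast⟩ := hF.exists_relabel hm (fun i => G i j)
      (fun i => (hrung i j hj).2 hjS) (hG.rung_zero hj) hd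
      (fun i => ⟨_, hout i, he i⟩)
    obtain ⟨B, hB, hBset, hB0, hB1⟩ := exists_of_square (hG.type 0 j' hj') (hG.rung_zero hj')
    have hdis : Disjoint (ladderSet m F') (ladderSet 2 B) := by
      rw [hFset, hBset, Set.disjoint_left]
      intro v hv hv'
      refine hout 0 (hpre.component_subset hv ?_)
      rw [Pregraph.component_eq hv']
      exact Pregraph.mem_component_self _ _
    have happ := hF'.append hB hdis (by
      intro i
      rw [hlast]
      fin_cases i
      · show 0 < P.under.edge s(G 0 j, B 0 0)
        rw [hB0]; exact he 0
      · show 0 < P.under.edge s(G 1 j, B 1 0)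
        rw [hB1]; exact he 1)
    have hmax := hS.le_of_ge (isQ1Ladder_iff.2 ⟨m + 2, by omega, _, happ, rfl⟩) (by
      rw [ladderSet_append, hFset]; exact Set.subset_union_left)
    rw [ladderSet_append, hFset, hBset] at hmax
    exact hn (hmax (.inr (Pregraph.mem_component_self _ _)))
  obtain ⟨_, hv, i₀, j₀, hj₀, rfl⟩ := hne
  rw [hrung _ _ hj₀] at hv
  have hup : ∀ j, j₀ ≤ j → j < k → G 0 j ∈ ladderSet m F := by
    intro j hj
    induction j, hj using Nat.le_induction with
    | base => exact fun _ => hv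
    | succ j _ ih =>
      exact fun hjk => hstep j (j + 1) (by omega) hjk (fun i => hG.rail i j hjk) (ih (by omega))
  have hdown : ∀ d, d ≤ j₀ → G 0 (j₀ - d) ∈ ladderSet m F := by
    intro d
    induction d with
    | zero => exact fun _ => hv
    | succ d ih =>
      intro hd
      refine hstep (j₀ - d) _ (by omega) (by omega) (fun i => ?_) (ih (by omega))
      have := hG.rail i (j₀ - (d + 1)) (by omega)
      rw [Sym2.eq_swap]
      rwa [show j₀ - (d + 1) + 1 = j₀ - d by omega] at this
  rintro _ ⟨i, j, hj, rfl⟩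
  rw [hrung _ _ hj]
  rcases le_total j₀ j with h | h
  · exact hup j h hj
  · have := hdown (j₀ - j) (by omega)
    rwa [show j₀ - (j₀ - j) = j by omega] at this

end LadderLabelling

/-! ### The block partition -/

theorem IsConnectedUnion.union {P : Marked V} {q : Pregraph W} {S T : Set V}
    (hS : P.IsConnectedUnion q S) (hT : P.IsConnectedUnion q T)
    (h : (P.under.induce (S ∪ T)).Connected) : P.IsConnectedUnion q (S ∪ T) := by
  refine ⟨h, ?_⟩
  rintro v (hv | hv)
  · exact ⟨(hS.2 v hv).1, (hS.2 v hv).2.trans Set.subset_union_left⟩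
  · exact ⟨(hT.2 v hv).1, (hT.2 v hv).2.trans Set.subset_union_right⟩

theorem connected_induce_iff (G : Pregraph V) (S : Set V) :
    (G.induce S).Connected ↔ (G.toSimple.induce S).Connected := by
  unfold Pregraph.Connected Pregraph.induce
  rw [Pregraph.toSimple_comap _ Subtype.val_injective]
  rfl

/-- Maximal connected unions of marked quotients that meet or are joined by an edge are equal. -/
theorem IsConnectedUnion.eq_of_maximal {P : Marked V} {q : Pregraph W} {S T : Set V}
    (hS : Maximal (P.IsConnectedUnion q) S) (hT : Maximal (P.IsConnectedUnion q) T)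
    (h : (S ∩ T).Nonempty ∨ ∃ u ∈ S, ∃ v ∈ T, 0 < P.under.edge s(u, v)) : S = T := by
  by_cases hne : (S ∩ T).Nonempty
  · have hST := hS.prop.union hT.prop (by
      rw [connected_induce_iff]
      exact SimpleGraph.induce_union_connected
        ((connected_induce_iff _ _).1 hS.prop.1).preconnected
        ((connected_induce_iff _ _).1 hT.prop.1).preconnected hne)
    exact (hS.eq_of_subset hST Set.subset_union_left).trans
      (hT.eq_of_subset hST Set.subset_union_right).symm
  · obtain ⟨u, hu, v, hv, huv⟩ := h.resolve_left hne
    have hadj : P.under.toSimple.Adj u v := ⟨fun h => hne ⟨u, hu, h ▸ hv⟩, huv⟩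
    have hST := hS.prop.union hT.prop (by
      rw [connected_induce_iff]
      exact SimpleGraph.connected_induce_union
        ((connected_induce_iff _ _).1 hS.prop.1).preconnected
        ((connected_induce_iff _ _).1 hT.prop.1).preconnected hu hv hadj)
    exact (hS.eq_of_subset hST Set.subset_union_left).trans
      (hT.eq_of_subset hST Set.subset_union_right).symm

/-- A common vertex forces equal types. For types `q₂` and `q₃` the union of the two sets is again
connected; for ladders the degree bound is needed, and each set contains the other. -/
theorem IsPreblock.eq_of_maximal [Fintype V] {P : Marked V} (hd : ∀ v, P.under.deg v ≤ 3)
    {t t' : Fin 4} {S T : Set V} (hS : Maximal (P.IsPreblock t) S)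
    (hT : Maximal (P.IsPreblock t') T) (h : (S ∩ T).Nonempty) : S = T := by
  obtain rfl : t = t' := by
    obtain ⟨v, hv, hv'⟩ := h
    exact (hS.prop.hasType hv).unique (hT.prop.hasType hv')
  fin_cases t
  · obtain ⟨m, -, F, hF, hF'⟩ := isQ1Ladder_iff.1 hS.prop
    obtain ⟨k, -, G, hG, hG'⟩ := isQ1Ladder_iff.1 hT.prop
    apply Set.Subset.antisymm
    · rw [← hF']
      exact LadderLabelling.subset_of_maximal hT hd hF (by rwa [hF', Set.inter_comm])
    · rw [← hG']
      exact LadderLabelling.subset_of_maximal hS hd hG (by rwa [hG'])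
  · exact IsConnectedUnion.eq_of_maximal hS hT (.inl h)
  · exact IsConnectedUnion.eq_of_maximal hS hT (.inl h)
  · obtain ⟨v, hv, rfl⟩ := hS.prop
    obtain ⟨w, hw, rfl⟩ := hT.prop
    obtain ⟨x, hx, hx'⟩ := h
    rw [← Pregraph.component_eq hx, ← Pregraph.component_eq hx']

/-- Each vertex lies in a block of its type. -/
theorem exists_preblock {P : Marked V} {t : Fin 4} {v : V} (h : P.zero.HasType t v) :
    ∃ S, P.IsPreblock t S ∧ v ∈ S := by
  have hU : ∀ {W : Type} (q : Pregraph W), P.zero.CompType q v →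
      P.IsConnectedUnion q (P.zero.component v) := by
    intro W q h
    refine ⟨?_, fun w hw => ⟨h.of_mem hw, (Pregraph.component_eq hw).subset⟩⟩
    rw [connected_induce_iff]
    have : (P.zero.toSimple.induce (P.zero.toSimple.connectedComponentMk v).supp).Connected :=
      SimpleGraph.ConnectedComponent.connected_toSimpleGraph _
    have hs : (P.zero.toSimple.connectedComponentMk v).supp = P.zero.component v := by
      ext w
      simp only [SimpleGraph.ConnectedComponent.mem_supp_iff, SimpleGraph.ConnectedComponent.eq,
        Pregraph.component, Set.mem_ofPred_eq]
      exact SimpleGraph.reachable_comm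
    rw [hs] at this
    refine this.mono ?_
    intro a b hab
    exact ⟨hab.1, Nat.add_pos_left hab.2 _⟩
  fin_cases t
  · obtain ⟨b, hb⟩ := Pregraph.CompType.exists_edge h
    obtain ⟨F, hF, hset, -⟩ := LadderLabelling.exists_of_square h hb
    exact ⟨_, isQ1Ladder_iff.2 ⟨2, le_rfl, F, hF, hset⟩, Pregraph.mem_component_self _ _⟩
  · exact ⟨_, hU _ h, Pregraph.mem_component_self _ _⟩
  · exact ⟨_, hU _ h, Pregraph.mem_component_self _ _⟩
  · exact ⟨_, ⟨v, h, rfl⟩, Pregraph.mem_component_self _ _⟩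

theorem IsPreblock.exists_maximal [Finite V] {P : Marked V} {t : Fin 4} {S : Set V}
    (h : P.IsPreblock t S) : ∃ T, S ⊆ T ∧ Maximal (P.IsPreblock t) T :=
  Finite.exists_le_maximal h

theorem IsPartial.deg_le [Fintype V] {P : Marked V} (h : P.IsPartial) (v : V) :
    P.under.deg v ≤ 3 := by
  rcases h.1 v with h | h <;> omega

/-- The block partition is a partition. -/
theorem IsPartial.existsUnique_block [Fintype V] {P : Marked V} (h : P.IsPartial) (v : V) :
    ∃! S, S ∈ P.blockPartition ∧ v ∈ S := by
  obtain ⟨t, ht⟩ := h.2.exists_hasType v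
  obtain ⟨S, hS, hv⟩ := exists_preblock ht
  obtain ⟨T, hST, hT⟩ := hS.exists_maximal
  refine ⟨T, ⟨isBlockSet_iff.2 ⟨t, hT⟩, hST hv⟩, ?_⟩
  rintro T' ⟨hT', hv'⟩
  obtain ⟨t', ht'⟩ := isBlockSet_iff.1 hT'
  exact IsPreblock.eq_of_maximal h.deg_le ht' hT ⟨v, hv', hST hv⟩

end Marked

/-! ### Adding and removing colour-1 edges; the cut -/

namespace Pregraph

variable {V W : Type*}

theorem deg_mono [Fintype V] {G H : Pregraph V} (he : ∀ e, G.edge e ≤ H.edge e)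
    (hs : ∀ v, G.semi v ≤ H.semi v) (v : V) : G.deg v ≤ H.deg v := by
  unfold deg
  gcongr
  exacts [he _, he _, hs _]

theorem edge_le_deg [Fintype V] (G : Pregraph V) (v w : V) : G.edge s(v, w) ≤ G.deg v := by
  have := Finset.single_le_sum (f := fun u => G.edge s(v, u)) (fun _ _ => Nat.zero_le _)
    (Finset.mem_univ w)
  unfold deg
  omega

/-- If the degree of `v` is the same in `G ≤ H`, then so are the edges at `v`. -/
theorem edge_eq_of_deg_le [Fintype V] {G H : Pregraph V} (he : ∀ e, G.edge e ≤ H.edge e)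
    (hs : ∀ v, G.semi v ≤ H.semi v) {v : V} (hd : H.deg v ≤ G.deg v) (w : V) :
    G.edge s(v, w) = H.edge s(v, w) := by
  by_contra hne
  have h1 : ∑ u, G.edge s(v, u) < ∑ u, H.edge s(v, u) :=
    Finset.sum_lt_sum (fun u _ => he _) ⟨w, Finset.mem_univ _, lt_of_le_of_ne (he _) hne⟩
  have h2 := he s(v, v)
  have h3 := hs v
  unfold deg at hd
  omega

end Pregraph

namespace Marked

variable {V W U : Type*}

/-- `Q` arises from `P` by adding edges of colour 1. -/
structure Le (P Q : Marked V) : Prop where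
  zero : P.zero = Q.zero
  semi : P.one.semi = Q.one.semi
  edge : ∀ e, P.one.edge e ≤ Q.one.edge e

theorem Le.refl (P : Marked V) : P.Le P := ⟨rfl, rfl, fun _ => le_rfl⟩

theorem Le.trans {P Q R : Marked V} (h : P.Le Q) (h' : Q.Le R) : P.Le R :=
  ⟨h.zero.trans h'.zero, h.semi.trans h'.semi, fun e => (h.edge e).trans (h'.edge e)⟩

theorem Le.comap {P Q : Marked V} (h : P.Le Q) (f : W → V) : (P.comap f).Le (Q.comap f) :=
  ⟨congrArg (Pregraph.comap f) h.zero, congrArg (· ∘ f) h.semi, fun _ => h.edge _⟩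

theorem Le.under_edge {P Q : Marked V} (h : P.Le Q) (e : Sym2 V) :
    P.under.edge e ≤ Q.under.edge e := by
  simp only [under, h.zero]
  exact Nat.add_le_add_left (h.edge e) _

theorem Le.deg_one [Fintype V] {P Q : Marked V} (h : P.Le Q) (v : V) :
    P.one.deg v ≤ Q.one.deg v :=
  Pregraph.deg_mono h.edge (fun v => (congrFun h.semi v).le) v

theorem Le.edge_eq [Fintype V] {P Q : Marked V} (h : P.Le Q) {v : V}
    (hd : Q.one.deg v ≤ P.one.deg v) {e : Sym2 V} (he : v ∈ e) : P.one.edge e = Q.one.edge e := by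
  obtain ⟨w, rfl⟩ := he
  exact Pregraph.edge_eq_of_deg_le h.edge (fun v => (congrFun h.semi v).le) hd w

theorem Le.isPartial [Fintype V] {P Q : Marked V} (h : P.Le Q) (hQ : Q.IsPartial) :
    P.IsPartial := by
  rw [isPartial_iff] at *
  exact ⟨fun v => (h.deg_one v).trans (hQ.1 v), h.zero ▸ hQ.2⟩

/-- New edges preserve preblocks, though not their maximality: blocks may grow or merge. -/
theorem IsPreblock.mono {P Q : Marked V} {t : Fin 4} {S : Set V} (h : P.IsPreblock t S)
    (hPQ : P.Le Q) : Q.IsPreblock t S :=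
  h.of_le_on hPQ.zero fun _ _ _ _ he => he.trans_le (hPQ.under_edge _)

open Classical in
/-- `P` without the edges of colour 1 between different blocks. -/
noncomputable def cut (P : Marked V) : Marked V where
  zero := P.zero
  one :=
    { edge := fun e => if ∃ S ∈ P.blockPartition, ∀ v ∈ e, v ∈ S then P.one.edge e else 0
      semi := P.one.semi }

theorem cut_le (P : Marked V) : P.cut.Le P := by
  refine ⟨rfl, rfl, fun e => ?_⟩
  simp only [cut]
  split_ifs <;> simp

theorem cut_edge_of_mem {P : Marked V} {S : Set V} (hS : S ∈ P.blockPartition) {e : Sym2 V}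
    (he : ∀ v ∈ e, v ∈ S) : P.cut.one.edge e = P.one.edge e :=
  if_pos ⟨S, hS, he⟩

/-- The edges inside a block belong to each marked pregraph between `Q.cut` and `Q`. -/
theorem edge_eq_of_cut_le {P Q : Marked V} (h1 : Q.cut.Le P) (h2 : P.Le Q) {S : Set V}
    (hS : S ∈ Q.blockPartition) {e : Sym2 V} (he : ∀ v ∈ e, v ∈ S) :
    P.one.edge e = Q.one.edge e :=
  (h2.edge e).antisymm ((cut_edge_of_mem hS he).symm.le.trans (h1.edge e))

theorem comap_eq_of_cut_le {P Q : Marked V} (h1 : Q.cut.Le P) (h2 : P.Le Q) {S : Set V}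
    (hS : S ∈ Q.blockPartition) {f : W → V} (hf : ∀ w, f w ∈ S) : P.comap f = Q.comap f := by
  refine Marked.ext (congrArg (Pregraph.comap f) h2.zero) (Pregraph.ext (funext fun e => ?_)
    (congrArg (· ∘ f) h2.semi))
  refine edge_eq_of_cut_le h1 h2 hS fun v hv => ?_
  obtain ⟨w, -, rfl⟩ := Sym2.mem_map.1 hv
  exact hf w

/-- The cut keeps all edges inside a block, and no other colour-1 edges matter for being a preblock.
-/
theorem isPreblock_of_cut_le {P Q : Marked V} (h1 : Q.cut.Le P) (h2 : P.Le Q) {t : Fin 4}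
    {S : Set V} (hS : Maximal (Q.IsPreblock t) S) : P.IsPreblock t S := by
  refine hS.prop.of_le_on h2.zero.symm fun u hu v hv he => ?_
  have : P.one.edge s(u, v) = Q.one.edge s(u, v) :=
    edge_eq_of_cut_le h1 h2 (isBlockSet_iff.2 ⟨t, hS⟩) (by simp [hu, hv])
  simpa only [under, h2.zero, this] using he

/-- Removing edges between different blocks does not change the block partition. -/
theorem blockPartition_eq_of_cut_le [Finite V] {P Q : Marked V} (h1 : Q.cut.Le P) (h2 : P.Le Q) :
    P.blockPartition = Q.blockPartition := by
  ext S
  simp only [blockPartition, Set.mem_ofPred_eq, isBlockSet_iff]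
  refine exists_congr fun t => ⟨fun hS => ?_, fun hS => ?_⟩
  -- The block of `Q` containing `S` is already a preblock of `P`, so maximality of `S` in `P` gives
  -- equality.
  · obtain ⟨T, hST, hT⟩ := (hS.prop.mono h2).exists_maximal
    rwa [hS.eq_of_subset (isPreblock_of_cut_le h1 h2 hT) hST]
  · exact ⟨isPreblock_of_cut_le h1 h2 hS, fun T hT hST => hS.2 (hT.mono h2) hST⟩

theorem HasBlockList.of_cut_le [Fintype V] {P Q : Marked V} {L : BlockList}
    (hL : Q.HasBlockList L) (h1 : Q.cut.Le P) (h2 : P.Le Q) : P.HasBlockList L := by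
  refine ⟨h2.isPartial hL.1, ?_⟩
  obtain ⟨e, he⟩ := hL.2
  refine ⟨e.trans (Equiv.setCongr (blockPartition_eq_of_cut_le h1 h2).symm), fun i => ?_⟩
  have : P.induce (e i : Set V) = Q.induce (e i : Set V) :=
    comap_eq_of_cut_le h1 h2 (e i).2 (fun w => w.2)
  exact this.symm ▸ he i

/-! ### Isomorphisms -/

theorem isPreblock_comap_equiv (P : Marked V) (σ : W ≃ V) (t : Fin 4) (S : Set W) :
    (P.comap σ).IsPreblock t S ↔ P.IsPreblock t (σ '' S) :=
  isPreblock_comap σ.injective (.of_surjective σ.surjective _) t S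

theorem maximal_isPreblock_comap (P : Marked V) (σ : W ≃ V) (t : Fin 4) (S : Set W) :
    Maximal ((P.comap σ).IsPreblock t) S ↔ Maximal (P.IsPreblock t) (σ '' S) := by
  constructor
  · refine fun h => ⟨(isPreblock_comap_equiv P σ t S).1 h.1, fun T hT hST => ?_⟩
    obtain ⟨T, rfl⟩ : ∃ T', σ '' T' = T := ⟨σ ⁻¹' T, Set.image_preimage_eq _ σ.surjective⟩
    exact Set.image_mono (h.2 ((isPreblock_comap_equiv P σ t T).2 hT)
      ((Set.image_subset_image_iff σ.injective).1 hST))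
  · refine fun h => ⟨(isPreblock_comap_equiv P σ t S).2 h.1, fun T hT hST => ?_⟩
    exact (Set.image_subset_image_iff σ.injective).1
      (h.2 ((isPreblock_comap_equiv P σ t T).1 hT) (Set.image_mono hST))

theorem mem_blockPartition_comap (P : Marked V) (σ : W ≃ V) (S : Set W) :
    S ∈ (P.comap σ).blockPartition ↔ σ '' S ∈ P.blockPartition := by
  simp only [blockPartition, Set.mem_ofPred_eq, isBlockSet_iff, maximal_isPreblock_comap]

/-- Isomorphisms permute blocks, so they respect the cut. This turns isomorphisms between outputs
into automorphisms of the starting graph. -/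
theorem cut_comap (P : Marked V) (σ : W ≃ V) : (P.comap σ).cut = P.cut.comap σ := by
  classical
  refine Marked.ext rfl (Pregraph.ext (funext fun e => ?_) rfl)
  show (if ∃ S ∈ (P.comap σ).blockPartition, ∀ v ∈ e, v ∈ S then P.one.edge (e.map σ) else 0) =
    if ∃ S ∈ P.blockPartition, ∀ v ∈ e.map σ, v ∈ S then P.one.edge (e.map σ) else 0
  refine if_congr ?_ rfl rfl
  constructor
  · rintro ⟨S, hS, he⟩
    refine ⟨σ '' S, (mem_blockPartition_comap P σ S).1 hS, fun v hv => ?_⟩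
    obtain ⟨w, hw, rfl⟩ := Sym2.mem_map.1 hv
    exact ⟨w, he w hw, rfl⟩
  · rintro ⟨S, hS, he⟩
    refine ⟨σ ⁻¹' S, (mem_blockPartition_comap P σ _).2 ?_, fun v hv => ?_⟩
    · rwa [Set.image_preimage_eq _ σ.surjective]
    · exact he _ (Sym2.mem_map.2 ⟨v, hv, rfl⟩)

theorem IsIso.cut {P : Marked V} {Q : Marked W} {σ : V ≃ W} (h : IsIso σ P Q) :
    IsIso σ P.cut Q.cut := by
  unfold IsIso at *
  rw [← h, cut_comap]

theorem isC4Marked_comap_equiv [Fintype V] [Fintype W] {P : Marked V} (h : P.IsC4Marked)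
    (σ : W ≃ V) : (P.comap σ).IsC4Marked := by
  rw [isC4Marked_iff] at *
  refine ⟨?_, fun w => ?_, h.2.2.comap σ.injective (.of_surjective σ.surjective _)⟩
  · have h' := h.1
    unfold Pregraph.Connected at *
    rw [under_comap, Pregraph.toSimple_comap _ σ.injective]
    exact (SimpleGraph.Iso.connected_iff (SimpleGraph.Iso.comap σ _)).2 h'
  · exact (Pregraph.deg_comap_equiv _ σ w).trans (h.2.1 _)

theorem IsC4Marked.isPartial [Fintype V] {P : Marked V} (h : P.IsC4Marked) : P.IsPartial :=
  ⟨fun v => .inr (h.2.1 v), h.2.2⟩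

/-- A block list up to the choice of its entries: `f i` embeds the entry `i` as a block. -/
theorem HasBlockList.exists_embeddings [Fintype V] {P : Marked V} {L : BlockList}
    (h : P.HasBlockList L) : ∃ f : ∀ i : Fin L.length, Fin (L.get i).order → V,
      (∀ i, Function.Injective (f i)) ∧ (∀ i, P.comap (f i) = (L.get i).graph) ∧
      (∀ i, Set.range (f i) ∈ P.blockPartition) ∧
      Function.Bijective (fun a : Σ i : Fin L.length, Fin (L.get i).order => f a.1 a.2) ∧
      ∀ S ∈ P.blockPartition, ∃ i, Set.range (f i) = S := by
  obtain ⟨hP, e, he⟩ := h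
  choose σ hσ using he
  have hr : ∀ i, Set.range (fun x => (σ i x : V)) = e i := by
    intro i
    rw [show (fun x => (σ i x : V)) = Subtype.val ∘ σ i from rfl,
      Set.range_comp, Equiv.range_eq_univ, Set.image_univ, Subtype.range_val]
  refine ⟨fun i x => σ i x, fun i => Subtype.val_injective.comp (σ i).injective, fun i => ?_,
    fun i => ?_, ⟨?_, ?_⟩, ?_⟩
  · rw [← hσ i, induce, comap_comap]; rfl
  · rw [hr]; exact (e i).2
  · rintro ⟨i, x⟩ ⟨j, y⟩ hxy
    simp only at hxy
    obtain rfl : i = j := by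
      apply e.injective
      apply Subtype.ext
      exact (hP.existsUnique_block (σ i x)).unique ⟨(e i).2, (σ i x).2⟩
        ⟨(e j).2, hxy ▸ (σ j y).2⟩
    rw [(σ i).injective (Subtype.ext hxy)]
  · intro v
    obtain ⟨S, ⟨hS, hv⟩, -⟩ := hP.existsUnique_block v
    have h : v ∈ (e (e.symm ⟨S, hS⟩) : Set V) := by simpa using hv
    exact ⟨⟨e.symm ⟨S, hS⟩, (σ _).symm ⟨v, h⟩⟩, by simp⟩
  · intro S hS
    exact ⟨e.symm ⟨S, hS⟩, (hr _).trans (by simp)⟩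

theorem closedRange_of_mem_blockPartition {P : Marked V} {f : W → V}
    (h : Set.range f ∈ P.blockPartition) : Pregraph.ClosedRange f P.zero := by
  obtain ⟨t, ht⟩ := isBlockSet_iff.1 h
  exact fun w v hv => ht.prop.mem_of_edge ⟨w, rfl⟩ hv

/-- Edges of `P.cut` stay inside a block. -/
theorem cut_edge_pos {P : Marked V} {e : Sym2 V} (h : 0 < P.cut.one.edge e) :
    ∃ S ∈ P.blockPartition, ∀ v ∈ e, v ∈ S := by
  by_contra hn
  simp [cut, hn] at h

/-- Without the edges between its blocks, a partial marked pregraph is the disjoint union of the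
entries of its block list. -/
theorem IsInitial.iso_cut [Fintype W] {P₀ : Marked V} {P : Marked W} {L : BlockList}
    (h₀ : P₀.IsInitial L) (h : P.HasBlockList L) : P₀.Iso P.cut := by
  obtain ⟨φ, hφ, hφ'⟩ := h₀
  obtain ⟨f, hf, hfg, hfB, hbij, -⟩ := h.exists_embeddings
  have hP := h.1
  have hgraph : ∀ i, P.cut.comap (f i) = P₀.comap (fun x => φ ⟨i, x⟩) := fun i => by
    rw [hφ, ← hfg, comap_eq_of_cut_le (Le.refl _) (cut_le P) (hfB i) fun w => ⟨w, rfl⟩]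
  have hsemi : ∀ a, P.cut.zero.semi (f a.1 a.2) = P₀.zero.semi (φ a) ∧
      P.cut.one.semi (f a.1 a.2) = P₀.one.semi (φ a) := fun ⟨i, x⟩ =>
    ⟨congrArg (fun R => R.zero.semi x) (hgraph i), congrArg (fun R => R.one.semi x) (hgraph i)⟩
  have hedge : ∀ a b, P.cut.zero.edge s(f a.1 a.2, f b.1 b.2) = P₀.zero.edge s(φ a, φ b) ∧
      P.cut.one.edge s(f a.1 a.2, f b.1 b.2) = P₀.one.edge s(φ a, φ b) := by
    rintro ⟨i, x⟩ ⟨j, y⟩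
    by_cases hij : i = j
    · subst hij
      exact ⟨congrArg (fun R => R.zero.edge s(x, y)) (hgraph i),
        congrArg (fun R => R.one.edge s(x, y)) (hgraph i)⟩
    -- Between different blocks both sides vanish: colour-0 edges never leave a block, and the cut
    -- has removed the others.
    · have h0 := hφ' ⟨i, x⟩ ⟨j, y⟩ hij
      simp only [under, Nat.add_eq_zero_iff] at h0
      have hnot : ∀ S ∈ P.blockPartition, f i x ∈ S → f j y ∉ S := by
        intro S hS hx hy
        have h1 := (hP.existsUnique_block _).unique ⟨hS, hx⟩ ⟨hfB i, ⟨x, rfl⟩⟩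
        obtain ⟨z, hz⟩ : f j y ∈ Set.range (f i) := h1 ▸ hy
        exact hij (congrArg Sigma.fst (@hbij.1 ⟨i, z⟩ ⟨j, y⟩ hz))
      rw [h0.1, h0.2]
      constructor
      · by_contra hne
        exact hnot _ (hfB i) ⟨x, rfl⟩
          (closedRange_of_mem_blockPartition (hfB i) _ _ (Nat.pos_of_ne_zero hne))
      · by_contra hne
        obtain ⟨S, hS, hS'⟩ := cut_edge_pos (Nat.pos_of_ne_zero hne)
        exact hnot S hS (hS' _ (Sym2.mem_mk_left _ _)) (hS' _ (Sym2.mem_mk_right _ _))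
  refine ⟨φ.symm.trans (Equiv.ofBijective _ hbij), ?_⟩
  have key : ∀ v, (φ.symm.trans (Equiv.ofBijective _ hbij)) v =
    f (φ.symm v).1 (φ.symm v).2 := fun _ => rfl
  refine Marked.ext (Pregraph.ext (funext fun e => ?_) (funext fun v => ?_))
    (Pregraph.ext (funext fun e => ?_) (funext fun v => ?_))
  · induction e using Sym2.ind with | _ u v
    simpa [comap, Pregraph.comap, key] using (hedge (φ.symm u) (φ.symm v)).1
  · simpa [comap, Pregraph.comap, key] using (hsemi (φ.symm v)).1
  · induction e using Sym2.ind with | _ u v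
    simpa [comap, Pregraph.comap, key] using (hedge (φ.symm u) (φ.symm v)).2
  · simpa [comap, Pregraph.comap, key] using (hsemi (φ.symm v)).2

/-- A spanning subgraph isomorphic to the whole graph is the whole graph. -/
theorem Le.eq_of_iso [Finite V] {P Q : Marked V} (h : P.Le Q) (h' : P.Iso Q) : P = Q := by
  classical
  have := Fintype.ofFinite V
  obtain ⟨σ, hσ⟩ := h'
  -- Isomorphic finite graphs have the same total colour-1 multiplicity, so the termwise inequality
  -- is an equality.
  have hsum : ∑ e, P.one.edge e = ∑ e, Q.one.edge e := by
    rw [← hσ]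
    refine Function.Bijective.sum_comp (e := Sym2.map σ) ?_ Q.one.edge
    exact ⟨Sym2.map.injective σ.injective, fun e => ⟨e.map σ.symm, by simp [Sym2.map_map]⟩⟩
  refine Marked.ext h.zero (Pregraph.ext (funext fun e => ?_) h.semi)
  exact (Finset.sum_eq_sum_iff_of_le fun e _ => h.edge e).1 hsum e (Finset.mem_univ _)

/-! ### Disjoint unions of blocks -/

section Initial

variable {P₀ : Marked V} {L : BlockList}

theorem IsInitial.exists_parts (h : P₀.IsInitial L) :
    ∃ f : ∀ i : Fin L.length, Fin (L.get i).order → V,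
      (∀ i, Function.Injective (f i)) ∧ (∀ i, P₀.comap (f i) = (L.get i).graph) ∧
      (∀ i, Pregraph.ClosedRange (f i) P₀.under) ∧ ∀ v, ∃ i, v ∈ Set.range (f i) := by
  obtain ⟨φ, hφ, hφ'⟩ := h
  refine ⟨fun i x => φ ⟨i, x⟩, fun i x y h => by simpa using h, hφ, fun i x v hv => ?_, fun v => ?_⟩
  · by_contra hn
    have h := hφ' ⟨i, x⟩ (φ.symm v) (fun h => hn ?_)
    · simp only [Equiv.apply_symm_apply] at h
      simp only [h] at hv
      exact absurd hv (lt_irrefl _)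
    · obtain ⟨⟨j, y⟩, rfl⟩ := φ.surjective v
      simp only [Equiv.symm_apply_apply] at h
      subst h
      exact ⟨y, rfl⟩
  · exact ⟨(φ.symm v).1, (φ.symm v).2, by simp⟩

theorem closedRange_zero_of_under {P : Marked V} {f : W → V}
    (h : Pregraph.ClosedRange f P.under) : Pregraph.ClosedRange f P.zero :=
  fun w v hv => h w v (Nat.add_pos_left hv _)

theorem IsInitial.isPartial [Fintype V] (h : P₀.IsInitial L) (hL : ∀ b ∈ L, b.IsBlock) :
    P₀.IsPartial := by
  obtain ⟨f, hf, hfg, hfc, hf'⟩ := h.exists_parts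
  have hb : ∀ i, (P₀.comap (f i)).IsPartial := fun i => by
    rw [hfg]; exact (hL _ (List.get_mem L i)).1
  have hz := fun i => closedRange_zero_of_under (hfc i)
  refine ⟨fun v => ?_, fun v => ?_, fun v => ?_⟩ <;> obtain ⟨i, x, rfl⟩ := hf' v
  · rw [← Pregraph.deg_comap (hf i) (hfc i)]; exact (hb i).1 x
  · rw [← Pregraph.deg_comap (hf i) (hz i)]; exact (hb i).2.1 x
  · simp only [← Pregraph.compType_comap (hf i) (hz i)]; exact (hb i).2.2 x

theorem IsInitial.isPreblock_range {f : ∀ i : Fin L.length, Fin (L.get i).order → V}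
    (hL : ∀ b ∈ L, b.IsBlock) (hf : ∀ i, Function.Injective (f i))
    (hfg : ∀ i, P₀.comap (f i) = (L.get i).graph)
    (hfc : ∀ i, Pregraph.ClosedRange (f i) P₀.under) (i : Fin L.length) :
    ∃ t, P₀.IsPreblock t (Set.range (f i)) := by
  obtain ⟨t, ht⟩ := isBlockSet_iff.1 (hL _ (List.get_mem L i)).2
  have h := ht.prop
  rw [← hfg, isPreblock_comap (hf i) (closedRange_zero_of_under (hfc i)), Set.image_univ] at h
  exact ⟨t, h⟩

/-- If `P` arises from the disjoint union `P₀` of the blocks in `L` by adding connections and still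
has block list `L`, then `P₀` is `P` without the edges between its blocks. -/
theorem IsInitial.eq_cut [Fintype V] (h : P₀.IsInitial L) (hL : ∀ b ∈ L, b.IsBlock)
    {P : Marked V} (hle : P₀.Le P) (hP : P.HasBlockList L) : P₀ = P.cut := by
  -- It suffices that `P₀` is contained in the cut. An edge of `P₀` lies inside one entry of `L`;
  -- this entry is a preblock of `P₀`, hence of `P`, and so lies in a single block of `P`.
  refine Le.eq_of_iso ⟨hle.zero, hle.semi, fun e => ?_⟩ (h.iso_cut hP)
  by_cases he : P₀.one.edge e = 0
  · rw [he]; exact Nat.zero_le _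
  obtain ⟨f, hf, hfg, hfc, hf'⟩ := h.exists_parts
  induction e using Sym2.ind with | _ u v
  obtain ⟨i, x, rfl⟩ := hf' u
  obtain ⟨t, ht⟩ := IsInitial.isPreblock_range hL hf hfg hfc i
  obtain ⟨T, hT, hT'⟩ := (ht.mono hle).exists_maximal
  have hv := hfc i x v (Nat.add_pos_right _ (Nat.pos_of_ne_zero he))
  rw [cut_edge_of_mem (isBlockSet_iff.2 ⟨t, hT'⟩)
    (by simp only [Sym2.mem_iff]; rintro w (rfl | rfl); exacts [hT ⟨x, rfl⟩, hT hv])]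
  exact hle.edge _

theorem IsPreblock.connected {P : Marked V} {t : Fin 4} {S : Set V} (h : P.IsPreblock t S) :
    (P.under.induce S).Connected := by
  fin_cases t
  · obtain ⟨m, hm, F, hF, rfl⟩ := isQ1Ladder_iff.1 h
    rw [connected_induce_iff]
    have h00 : F 0 0 ∈ ladderSet m F := ⟨0, 0, by omega, rfl⟩
    have hrow : ∀ i j (hj : j < m), (P.under.toSimple.induce (ladderSet m F)).Reachable
        ⟨F i 0, i, 0, by omega, rfl⟩ ⟨F i j, i, j, hj, rfl⟩ := by
      intro i j
      induction j with
      | zero => exact fun _ => SimpleGraph.Reachable.refl _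
      | succ j ih =>
        intro hj
        refine (ih (by omega)).trans (SimpleGraph.Adj.reachable ⟨?_, hF.rail i j hj⟩)
        exact fun h' => by have := (hF.inj _ _ _ _ (by omega) hj h').2; omega
    have hcol : (P.under.toSimple.induce (ladderSet m F)).Reachable
        ⟨F 0 0, h00⟩ ⟨F 1 0, 1, 0, by omega, rfl⟩ :=
      SimpleGraph.Adj.reachable ⟨fun h' => by
        have := (hF.inj _ _ _ _ (by omega) (by omega) h').1
        exact absurd this (by decide), hF.rung 0 (by omega)⟩
    have hall : ∀ v : ladderSet m F, (P.under.toSimple.induce (ladderSet m F)).Reachable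
        ⟨F 0 0, h00⟩ v := by
      rintro ⟨_, i, j, hj, rfl⟩
      refine SimpleGraph.Reachable.trans ?_ (hrow i j hj)
      fin_cases i
      exacts [SimpleGraph.Reachable.refl _, hcol]
    exact (SimpleGraph.connected_iff _).2 ⟨fun u v => (hall u).symm.trans (hall v), ⟨⟨_, h00⟩⟩⟩
  · exact h.1
  · exact h.1
  · obtain ⟨v, hv, rfl⟩ := h
    rw [connected_induce_iff]
    have : Subsingleton (P.zero.component v) := by
      have := hv.ncard
      rw [Nat.card_fin] at this
      obtain ⟨a, ha⟩ := Set.ncard_eq_one.1 this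
      rw [ha]; infer_instance
    exact (SimpleGraph.connected_iff _).2 ⟨fun a b => Subsingleton.elim a b ▸ SimpleGraph.Reachable.refl _,
      ⟨⟨v, Pregraph.mem_component_self _ _⟩⟩⟩

theorem component_of_connected_induce {G : Pregraph V} {S : Set V} (h : (G.induce S).Connected)
    {v : V} (hv : v ∈ S) : S ⊆ G.component v := by
  rw [connected_induce_iff] at h
  intro w hw
  exact (h.preconnected ⟨v, hv⟩ ⟨w, hw⟩).map (SimpleGraph.Embedding.induce S).toHom

end Initial

end Marked

/-! ### Existence, invariance and acceptability of block lists -/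

namespace Marked

variable {V W U : Type*}

theorem induce_comap_iso (P : Marked V) {f : W → V} (hf : Function.Injective f) (S : Set W) :
    ((P.comap f).induce S).Iso (P.induce (f '' S)) := by
  refine ⟨Equiv.Set.image f S hf, ?_⟩
  simp only [IsIso, induce, comap_comap]
  rfl

theorem IsPartial.exists_hasBlockList [Fintype V] {P : Marked V} (h : P.IsPartial) :
    ∃ L, P.HasBlockList L := by
  let b : P.blockPartition → FinMarked := fun S =>
    ⟨Nat.card (S : Set V), P.comap fun x => ((Finite.equivFin (S : Set V)).symm x : V)⟩
  let e := Finite.equivFin P.blockPartition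
  refine ⟨List.ofFn fun i => b (e.symm i), h, (finCongr List.length_ofFn).trans e.symm,
    fun i => ?_⟩
  rw [List.get_ofFn]
  exact ⟨(Finite.equivFin _).symm, comap_comap _ _ _⟩

theorem HasBlockList.of_equiv [Fintype V] {P : Marked V} {L L' : BlockList}
    (h : P.HasBlockList L) (hL : L.Equiv L') : P.HasBlockList L' := by
  obtain ⟨hP, e, he⟩ := h
  obtain ⟨e', he'⟩ := hL
  refine ⟨hP, e'.symm.trans e, fun i => ?_⟩
  have := (he' (e'.symm i)).symm.trans (he _)
  rwa [e'.apply_symm_apply] at this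

theorem HasBlockList.equiv [Fintype V] {P : Marked V} {L L' : BlockList}
    (h : P.HasBlockList L) (h' : P.HasBlockList L') : L.Equiv L' := by
  obtain ⟨-, e, he⟩ := h
  obtain ⟨-, e', he'⟩ := h'
  refine ⟨e.trans e'.symm, fun i => (he i).trans (Iso.symm ?_)⟩
  have h := he' (e'.symm (e i))
  rwa [e'.apply_symm_apply] at h

theorem HasBlockList.comap_equiv [Fintype V] [Fintype W] {P : Marked V} {L : BlockList}
    (h : P.HasBlockList L) (σ : W ≃ V) : (P.comap σ).HasBlockList L := by
  obtain ⟨hP, e, he⟩ := h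
  refine ⟨hP.comap σ.injective (.of_surjective σ.surjective _), e.trans
    ((Equiv.Set.congr σ).subtypeEquiv fun S => mem_blockPartition_comap P σ S).symm, fun i => ?_⟩
  set S := ((Equiv.Set.congr σ).subtypeEquiv fun S => mem_blockPartition_comap P σ S).symm (e i)
    with hS
  have hS' : σ '' (S : Set W) = e i := by
    rw [Equiv.eq_symm_apply] at hS
    rw [← hS]; rfl
  have h := P.induce_comap_iso σ.injective (S : Set W)
  rw [hS'] at h
  exact (he i).trans h.symm

theorem HasBlockList.equiv_of_iso [Fintype V] [Fintype W] {P : Marked V} {Q : Marked W}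
    {L L' : BlockList} (h : P.HasBlockList L) (h' : Q.HasBlockList L') (hPQ : P.Iso Q) :
    L.Equiv L' := by
  obtain ⟨σ, rfl⟩ := hPQ
  exact h.equiv (h'.comap_equiv σ)

/-- A vertex of type `q` has no neighbour of type `q` in another block, if `q` is the digon or the
edge with two semi-edges. -/
theorem edge_eq_zero_of_type {P : Marked V} {t : Fin 4}
    (ht : t = 1 ∨ t = 2) {u v : V} (hu : P.zero.HasType t u) (hv : P.zero.HasType t v)
    {S T : Set V} (hS : S ∈ P.blockPartition) (hT : T ∈ P.blockPartition) (huS : u ∈ S)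
    (hvT : v ∈ T) (hne : S ≠ T) : P.one.edge s(u, v) = 0 := by
  obtain ⟨t₁, hS'⟩ := isBlockSet_iff.1 hS
  obtain ⟨t₂, hT'⟩ := isBlockSet_iff.1 hT
  obtain rfl := (hS'.prop.hasType huS).unique hu
  obtain rfl := (hT'.prop.hasType hvT).unique hv
  by_contra he
  refine hne ?_
  have he' : 0 < P.under.edge s(u, v) := Nat.add_pos_right _ (Nat.pos_of_ne_zero he)
  rcases ht with rfl | rfl
  · exact IsConnectedUnion.eq_of_maximal hS' hT' (.inr ⟨u, huS, v, hvT, he'⟩)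
  · exact IsConnectedUnion.eq_of_maximal hS' hT' (.inr ⟨u, huS, v, hvT, he'⟩)

section Multigraph

variable [Fintype V] {ι : Type*} [DecidableEq ι]

/-- The number of ends of edges at `v` that lead to another part of the partition into the fibres of
`β`. -/
def outDegree (G : Pregraph V) (β : V → ι) (v : V) : ℕ :=
  ∑ w, if β w = β v then 0 else G.edge s(v, w)

/-- The loopless multigraph obtained by identifying the vertices in each fibre of `β`. -/
def quotientGraph (G : Pregraph V) (β : V → ι) : Pregraph ι where
  edge := Sym2.lift ⟨fun i j => if i = j then 0 else
      ∑ u, ∑ v, if β u = i ∧ β v = j then G.edge s(u, v) else 0, fun i j => by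
    simp only [eq_comm (a := i) (b := j)]
    refine if_congr Iff.rfl rfl ?_
    rw [Finset.sum_comm]
    refine Finset.sum_congr rfl fun u _ => Finset.sum_congr rfl fun v _ => ?_
    rw [Sym2.eq_swap]
    exact if_congr and_comm rfl rfl⟩
  semi _ := 0

/-- After exchanging the sums, an edge end from `u` to `v` counts only for the part `j = β v`, and
only if this differs from the part of `u`. -/
theorem deg_quotientGraph [Fintype ι] (G : Pregraph V) (β : V → ι) (i : ι) :
    (quotientGraph G β).deg i = ∑ u, if β u = i then outDegree G β u else 0 := by
  have h : (quotientGraph G β).deg i = ∑ j, if i = j then 0 else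
      ∑ u, ∑ v, if β u = i ∧ β v = j then G.edge s(u, v) else 0 := by
    simp [Pregraph.deg, quotientGraph]
  have h' : ∀ j, (if i = j then 0 else
      ∑ u, ∑ v, if β u = i ∧ β v = j then G.edge s(u, v) else 0) =
      ∑ u, ∑ v, if i = j then 0 else if β u = i ∧ β v = j then G.edge s(u, v) else 0 := by
    intro j; split_ifs <;> simp
  rw [h, Finset.sum_congr rfl fun j _ => h' j, Finset.sum_comm]
  refine Finset.sum_congr rfl fun u _ => ?_
  rw [Finset.sum_comm]
  split_ifs with hu
  · unfold outDegree
    refine Finset.sum_congr rfl fun v _ => ?_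
    rw [Finset.sum_eq_single (β v)]
    · simp only [hu, eq_comm (a := i), and_true, if_true]
    · intro j _ hj
      simp [hj.symm]
    · simp
  · simp [hu]

theorem quotientGraph_edge_pos (G : Pregraph V) (β : V → ι) {u v : V} (h : 0 < G.edge s(u, v))
    (hne : β u ≠ β v) : 0 < (quotientGraph G β).edge s(β u, β v) := by
  have h1 : (quotientGraph G β).edge s(β u, β v) =
      ∑ u', ∑ v', if β u' = β u ∧ β v' = β v then G.edge s(u', v') else 0 := if_neg hne
  rw [h1]
  refine Finset.sum_pos' (fun _ _ => Nat.zero_le _) ⟨u, Finset.mem_univ _, ?_⟩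
  refine Finset.sum_pos' (fun _ _ => Nat.zero_le _) ⟨v, Finset.mem_univ _, ?_⟩
  simpa using h

/-- If no edge joins two vertices of `A` in different parts, then at most half of the ends of edges
between different parts lie in `A`. -/
theorem two_mul_outDegree_le (G : Pregraph V) (β : V → ι) (A : V → Prop) [DecidablePred A]
    (h : ∀ u v, A u → A v → β u ≠ β v → G.edge s(u, v) = 0) :
    2 * (∑ v, if A v then outDegree G β v else 0) ≤ ∑ v, outDegree G β v := by
  have h1 : (∑ v, if A v then outDegree G β v else 0) ≤
      ∑ v, if A v then 0 else outDegree G β v := by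
    calc (∑ v, if A v then outDegree G β v else 0)
        ≤ ∑ v, ∑ w, if A v ∧ ¬ A w ∧ β w ≠ β v then G.edge s(v, w) else 0 := by
          refine Finset.sum_le_sum fun v _ => ?_
          split_ifs with hv
          · refine Finset.sum_le_sum fun w _ => ?_
            by_cases hw : β w = β v
            · simp [hw]
            · by_cases hAw : A w
              · simp [h v w hv hAw (Ne.symm hw)]
              · simp [hv, hAw, hw]
          · exact Nat.zero_le _
      _ = ∑ w, ∑ v, if A v ∧ ¬ A w ∧ β w ≠ β v then G.edge s(v, w) else 0 := Finset.sum_comm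
      _ ≤ ∑ v, if A v then 0 else outDegree G β v := by
          refine Finset.sum_le_sum fun w _ => ?_
          split_ifs with hw
          · simp [hw]
          · refine Finset.sum_le_sum fun v _ => ?_
            rw [Sym2.eq_swap]
            by_cases hv : β v = β w
            · simp [hv]
            · rw [if_neg hv]; split_ifs <;> simp
  have h2 : (∑ v, if A v then outDegree G β v else 0) +
      (∑ v, if A v then 0 else outDegree G β v) = ∑ v, outDegree G β v := by
    rw [← Finset.sum_add_distrib]
    refine Finset.sum_congr rfl fun v _ => ?_
    split_ifs <;> simp
  omega

end Multigraph

theorem sum_map_eq {α : Type*} (L : List α) (g : α → ℕ) :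
    (L.map g).sum = ∑ i : Fin L.length, g (L.get i) := by
  rw [← List.sum_ofFn]
  congr 1
  exact (List.ext_get (by simp) (by simp))

theorem sum_filter_map_eq {α : Type*} (L : List α) (g : α → ℕ) (p : α → Prop)
    [DecidablePred p] :
    ((L.filter fun a => p a).map g).sum = ∑ i : Fin L.length, if p (L.get i) then g (L.get i)
      else 0 := by
  rw [← sum_map_eq L fun a => if p a then g a else 0]
  induction L with
  | nil => rfl
  | cons a L ih =>
    by_cases h : p a
    · simp [h, ← ih]
    · simp [h, ← ih]

section Acceptable

variable [Fintype V] {P : Marked V} {L : BlockList}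

theorem isBlock_of_comap {f : ∀ i : Fin L.length, Fin (L.get i).order → V} (hP : P.IsPartial)
    (hf : ∀ i, Function.Injective (f i)) (hfg : ∀ i, P.comap (f i) = (L.get i).graph)
    (hfB : ∀ i, Set.range (f i) ∈ P.blockPartition) : ∀ b ∈ L, b.IsBlock := by
  intro b hb
  obtain ⟨i, rfl⟩ := List.get_of_mem hb
  have hc := closedRange_of_mem_blockPartition (hfB i)
  unfold FinMarked.IsBlock
  rw [← hfg]
  refine ⟨hP.comap (hf i) hc, isBlockSet_iff.2 ?_⟩
  obtain ⟨t, ht⟩ := isBlockSet_iff.1 (hfB i)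
  refine ⟨t, ?_, fun T _ _ => Set.subset_univ T⟩
  rw [isPreblock_comap (hf i) hc, Set.image_univ]
  exact ht.prop

/-- Each vertex of `P` has colour-1 degree 1, so it is deficient in its own block exactly when it
has a colour-1 edge leaving the block. Here `β` assigns to a vertex the index of its block. -/
theorem numDeficient_eq {f : ∀ i : Fin L.length, Fin (L.get i).order → V} {β : V → Fin L.length}
    (hP : P.IsC4Marked) (hf : ∀ i, Function.Injective (f i))
    (hfg : ∀ i, P.comap (f i) = (L.get i).graph)
    (hfB : ∀ i, Set.range (f i) ∈ P.blockPartition)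
    (hβ : ∀ v i, β v = i ↔ v ∈ Set.range (f i)) (i : Fin L.length) :
    (L.get i).numDeficient = ∑ v, if β v = i then outDegree P.one β v else 0 := by
  classical
  have hc := closedRange_of_mem_blockPartition (hfB i)
  have hbf : ∀ x, β (f i x) = i := fun x => (hβ _ _).2 ⟨x, rfl⟩
  have hdeg : ∀ x, (P.comap (f i)).one.deg x + outDegree P.one β (f i x) = 1 := by
    intro x
    rw [← (isC4Marked_iff.1 hP).2.1 (f i x)]
    have h1 : ∑ y, P.one.edge s(f i x, f i y) =
        ∑ w, if β w = i then P.one.edge s(f i x, w) else 0 := by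
      refine Fintype.sum_of_injective (f i) (hf i) _ _ (fun w hw => ?_) (fun y => ?_)
      · rw [if_neg fun h => hw ((hβ _ _).1 h)]
      · rw [if_pos (hbf y)]
    have h2 : (∑ w, if β w = i then P.one.edge s(f i x, w) else 0) + outDegree P.one β (f i x) =
        ∑ w, P.one.edge s(f i x, w) := by
      rw [outDegree, ← Finset.sum_add_distrib, hbf]
      refine Finset.sum_congr rfl fun w _ => ?_
      split_ifs <;> simp
    have h3 : (P.comap (f i)).one.deg x = (∑ y, P.one.edge s(f i x, f i y)) +
      P.one.edge s(f i x, f i x) + P.one.semi (f i x) := rfl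
    have h4 : P.one.deg (f i x) = (∑ w, P.one.edge s(f i x, w)) +
      P.one.edge s(f i x, f i x) + P.one.semi (f i x) := rfl
    omega
  have hnum : (L.get i).numDeficient = ∑ x, outDegree P.one β (f i x) := by
    unfold FinMarked.numDeficient
    rw [← hfg, Set.ncard_eq_toFinset_card', Finset.card_eq_sum_ones,
      ← Finset.sum_filter_add_sum_filter_not Finset.univ
      (fun x => (P.comap (f i)).Deficient x)]
    have hz : (P.comap (f i)).zero.IsC4QuotientFactor := hP.2.2.comap (hf i) hc
    rw [Finset.sum_eq_zero (s := Finset.univ.filter fun x => ¬ (P.comap (f i)).Deficient x),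
      add_zero]
    · refine Finset.sum_congr (by ext; simp) fun x hx => ?_
      rw [Finset.mem_filter, deficient_iff hz] at hx
      have := hdeg x
      omega
    · intro x hx
      rw [Finset.mem_filter, deficient_iff hz] at hx
      have := hdeg x
      omega
  rw [hnum]
  refine Fintype.sum_of_injective (f i) (hf i) _ _ (fun w hw => ?_) (fun y => ?_)
  · rw [if_neg fun h => hw ((hβ _ _).1 h)]
  · rw [if_pos (hbf y)]

/-- The block list of a `C₄`-quotient-marked pregraph is acceptable. -/
theorem HasBlockList.acceptable (h : P.HasBlockList L) (hP : P.IsC4Marked) :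
    L.Acceptable ∧ L.order = Fintype.card V := by
  classical
  obtain ⟨f, hf, hfg, hfB, hbij, -⟩ := h.exists_embeddings
  let ψ := Equiv.ofBijective _ hbij
  let β : V → Fin L.length := fun v => (ψ.symm v).1
  have hβ : ∀ v i, β v = i ↔ v ∈ Set.range (f i) := by
    intro v i
    obtain ⟨⟨j, x⟩, rfl⟩ := ψ.surjective v
    simp only [β, Equiv.symm_apply_apply]
    constructor
    · rintro rfl; exact ⟨x, rfl⟩
    · rintro ⟨y, hy⟩
      exact (congrArg Sigma.fst (ψ.injective (a₁ := ⟨i, y⟩) (a₂ := ⟨j, x⟩) hy)).symm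
  have hnum := numDeficient_eq hP hf hfg hfB hβ
  have hsum : ∀ g : V → ℕ, (∑ i, ∑ v, if β v = i then g v else 0) = ∑ v, g v := by
    intro g
    rw [Finset.sum_comm]
    simp
  have hmissing : L.missing = ∑ v, outDegree P.one β v := by
    rw [BlockList.missing, sum_map_eq, Finset.sum_congr rfl fun i _ => hnum i, hsum]
  have hhalf : ∀ (W : Type) (q : Pregraph W) (t : Fin 4), (t = 1 ∨ t = 2) →
      P.zero.HasType t = P.zero.CompType q → 2 * L.missingIn q ≤ L.missing := by
    intro W q t ht hq
    rw [hmissing]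
    refine le_trans ?_ (two_mul_outDegree_le P.one β (P.zero.CompType q) ?_)
    · refine Nat.mul_le_mul_left 2 ?_
      rw [BlockList.missingIn, sum_filter_map_eq, ← hsum]
      refine Finset.sum_le_sum fun i _ => ?_
      split_ifs with hi
      · rw [hnum]
        refine Finset.sum_le_sum fun v _ => ?_
        split_ifs with h1 h2
        · exact le_rfl
        · obtain ⟨x, rfl⟩ := (hβ _ _).1 h1
          have hx := hi x
          rw [← hfg] at hx
          exact absurd ((Pregraph.compType_comap (hf i)
            (closedRange_of_mem_blockPartition (hfB i)) q x).1 hx) h2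
        · exact le_rfl
      · exact Nat.zero_le _
    · intro u v hu hv huv
      rw [← hq] at hu hv
      refine edge_eq_zero_of_type ht hu hv (hfB (β u)) (hfB (β v)) ((hβ _ _).1 rfl)
        ((hβ _ _).1 rfl) fun h => huv ?_
      exact ((hβ _ _).2 (h ▸ (hβ _ _).1 rfl)).symm
  refine ⟨⟨isBlock_of_comap h.1 hf hfg hfB, ?_, hhalf _ _ 1 (.inl rfl) rfl,
    hhalf _ _ 2 (.inr rfl) rfl⟩, ?_⟩
  · refine ⟨quotientGraph P.one β, ?_, fun i => if_pos rfl, fun _ => rfl, fun i => ?_⟩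
    -- Paths of `P` project to the quotient: a step that changes the block must have colour 1.
    · have hadj : ∀ u v, P.under.toSimple.Reachable u v →
          (quotientGraph P.one β).toSimple.Reachable (β u) (β v) := by
        intro u v huv
        rw [SimpleGraph.reachable_iff_reflTransGen] at huv
        induction huv with
        | refl => exact SimpleGraph.Reachable.refl _
        | @tail w v _ hwv ih =>
          refine ih.trans ?_
          by_cases hne : β w = β v
          · rw [hne]
          · refine SimpleGraph.Adj.reachable ⟨hne, quotientGraph_edge_pos _ _ ?_ hne⟩
            rcases Nat.add_pos_iff_pos_or_pos.1 hwv.2 with h0 | h1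
            · obtain ⟨x, hx⟩ := (hβ w _).1 rfl
              rw [← hx] at h0
              exact absurd ((hβ _ _).2
                (closedRange_of_mem_blockPartition (hfB (β w)) x v h0)).symm hne
            · exact h1
      obtain ⟨v₀⟩ := hP.1.nonempty
      refine (SimpleGraph.connected_iff _).2 ⟨fun i j => ?_, ⟨β v₀⟩⟩
      have hsurj : ∀ i, ∃ v, β v = i := fun i => by
        obtain ⟨t, ht⟩ := isBlockSet_iff.1 (hfB i)
        obtain ⟨v, hv⟩ := ht.prop.nonempty
        exact ⟨v, (hβ _ _).2 hv⟩
      obtain ⟨u, rfl⟩ := hsurj i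
      obtain ⟨v, rfl⟩ := hsurj j
      exact hadj u v (hP.1.preconnected u v)
    · rw [hnum, deg_quotientGraph]
  · rw [BlockList.order, sum_map_eq, ← Fintype.card_congr ψ, Fintype.card_sigma]
    simp

end Acceptable

end Marked

namespace Marked

variable {V : Type*}

/-! ### Adding connections -/

section Connect

variable {P : Marked V} {M : Set (Sym2 V)}

theorem le_connect (P : Marked V) (M : Set (Sym2 V)) : P.Le (P.connect M) :=
  ⟨rfl, rfl, fun _ => Nat.le_add_right _ _⟩

theorem connect_edge_of_notMem {e : Sym2 V} (he : e ∉ M) :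
    (P.connect M).one.edge e = P.one.edge e := by
  simp [connect, he]

theorem connect_edge_of_mem {e : Sym2 V} (he : e ∈ M) :
    (P.connect M).one.edge e = P.one.edge e + 1 := by
  simp [connect, he]

variable [Fintype V]

theorem deg_connect_of_mem (hM : P.IsConnectionSet M) {v : V} {e : Sym2 V} (he : e ∈ M)
    (hv : v ∈ e) : (P.connect M).one.deg v = P.one.deg v + 1 := by
  classical
  obtain ⟨w, rfl⟩ := hv
  have hdiag : s(v, v) ∉ M := fun h => (hM.1 _ h).1 rfl
  have hu : ∀ u, (P.connect M).one.edge s(v, u) = P.one.edge s(v, u) + if u = w then 1 else 0 := by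
    intro u
    split_ifs with h
    · rw [h]; exact connect_edge_of_mem he
    · refine connect_edge_of_notMem fun h' => h ?_
      exact Sym2.congr_right.1
        (hM.2 _ h' _ he v (Sym2.mem_mk_left _ _) (Sym2.mem_mk_left _ _))
  unfold Pregraph.deg
  rw [connect_edge_of_notMem hdiag, Finset.sum_congr rfl fun u _ => hu u, Finset.sum_add_distrib,
    Finset.sum_ite_eq' Finset.univ w, if_pos (Finset.mem_univ _)]
  simp only [connect]
  omega

theorem deg_connect_of_forall_notMem {v : V} (hv : ∀ e ∈ M, v ∉ e) :
    (P.connect M).one.deg v = P.one.deg v := by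
  have hu : ∀ u, (P.connect M).one.edge s(v, u) = P.one.edge s(v, u) :=
    fun u => connect_edge_of_notMem fun h => hv _ h (Sym2.mem_mk_left _ _)
  unfold Pregraph.deg
  simp only [hu]
  rfl

theorem not_deficient_connect (hM : P.IsConnectionSet M) {v : V} {e : Sym2 V} (he : e ∈ M)
    (hv : v ∈ e) : ¬ (P.connect M).Deficient v := by
  have h := (hM.1 e he).2 v hv
  unfold Deficient at *
  rw [deg_under] at *
  rw [deg_connect_of_mem hM he hv]
  simp only [connect]
  omega

theorem deficient_of_connect (hM : P.IsConnectionSet M) {v : V}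
    (hv : (P.connect M).Deficient v) : P.Deficient v := by
  by_cases h : ∃ e ∈ M, v ∈ e
  · obtain ⟨e, he, hve⟩ := h
    exact (hM.1 e he).2 v hve
  · push Not at h
    unfold Deficient at *
    rw [deg_under, deg_connect_of_forall_notMem h] at hv
    rwa [deg_under]

end Connect

/-! ### Termination -/

section Termination

variable [Fintype V] {L : BlockList}

/-- The chosen orbit is nonempty and all its vertices get saturated, while no vertex becomes
deficient. -/
theorem Calls.ncard_lt {P Q : Marked V} (h : Calls L Q P) :
    {v | Q.Deficient v}.ncard < {v | P.Deficient v}.ncard := by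
  obtain ⟨-, R, ⟨O, ⟨⟨v, hv, hO⟩, -⟩, hR, -⟩, hQ⟩ := h
  obtain ⟨M, hM, -, hMO, rfl, -⟩ := hR Q hQ
  obtain ⟨e, he, hve⟩ := hMO v (hO ▸ MulAction.mem_orbit_self v)
  refine Set.ncard_lt_ncard ⟨fun w hw => deficient_of_connect hM hw, fun h => ?_⟩ (Set.toFinite _)
  exact not_deficient_connect hM he hve (h hv)

theorem wellFounded_calls : WellFounded (Calls (V := V) L) :=
  Subrelation.wf (fun h => Calls.ncard_lt h)
    (measure fun P : Marked V => {v | P.Deficient v}.ncard).wf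

/-- A list of representatives of a finite set with respect to a reflexive relation. -/
theorem exists_representatives {α : Type*} {s : Set α} (hs : s.Finite) (r : α → α → Prop)
    (hr : ∀ a, r a a) : ∃ l : List α, (∀ a ∈ l, a ∈ s) ∧ l.Pairwise (fun a b => ¬ r a b) ∧
      ∀ a ∈ s, ∃ b ∈ l, r a b := by
  induction s, hs using Set.Finite.induction_on with
  | empty => exact ⟨[], by simp⟩
  | @insert a s _ _ ih =>
    obtain ⟨l, h1, h2, h3⟩ := ih
    by_cases ha : ∃ b ∈ l, r a b
    · refine ⟨l, fun b hb => .inr (h1 b hb), h2, ?_⟩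
      rintro b (rfl | hb)
      exacts [ha, h3 b hb]
    · push Not at ha
      refine ⟨a :: l, ?_, List.pairwise_cons.2 ⟨ha, h2⟩, ?_⟩
      · intro b hb
        rcases List.mem_cons.1 hb with rfl | hb
        exacts [.inl rfl, .inr (h1 b hb)]
      · rintro b (rfl | hb)
        · exact ⟨b, List.mem_cons_self, hr b⟩
        · obtain ⟨c, hc, hbc⟩ := h3 b hb
          exact ⟨c, List.mem_cons_of_mem _ hc, hbc⟩

theorem exists_children {P : Marked V} (hP : ∃ v, P.Deficient v) : ∃ R, Children L P R := by
  obtain ⟨v, hv, hmin⟩ := Set.exists_min_image {v | P.Deficient v}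
    (fun v => (MulAction.orbit P.aut v).ncard) (Set.toFinite _) hP
  have hfin : {Q | IsOrbitConnection L (MulAction.orbit P.aut v) P Q}.Finite := by
    refine (Set.finite_range P.connect).subset ?_
    rintro Q ⟨M, -, -, -, rfl, -⟩
    exact ⟨M, rfl⟩
  obtain ⟨R, h1, h2, h3⟩ := exists_representatives hfin (fun Q Q' => Q.Iso Q') Iso.refl
  exact ⟨R, _, ⟨⟨v, hv, rfl⟩, hmin⟩, h1, h2, h3⟩

theorem exists_recurse (P : Marked V) : ∃ out, Recurse L P out := by
  classical
  induction P using (wellFounded_calls (V := V) (L := L)).induction with | _ P ih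
  by_cases hd : ∃ v, P.Deficient v
  · by_cases ht : P.AutTrivialOnDeficient
    · have hfin : {Q | IsCompletion L P Q}.Finite := by
        refine (Set.finite_range P.connect).subset ?_
        rintro Q ⟨M, -, -, rfl, -⟩
        exact ⟨M, rfl⟩
      exact ⟨_, .complete P hd ht hfin.toFinset.toList (Finset.nodup_toList _)
        fun Q => by simp⟩
    · obtain ⟨R, hR⟩ := exists_children (L := L) hd
      have : ∀ Q, ∃ out, Q ∈ R → Recurse L Q out := fun Q => by
        by_cases hQ : Q ∈ R
        · obtain ⟨out, h⟩ := ih Q ⟨ht, R, hR, hQ⟩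
          exact ⟨out, fun _ => h⟩
        · exact ⟨[], fun h => absurd h hQ⟩
      choose out hout using this
      exact ⟨_, .branch P ht R hR out hout⟩
  · push Not at hd
    exact ⟨_, .done P hd⟩

end Termination

/-! ### The outputs -/

section Output

variable [Fintype V] {L : BlockList}

/-- The alternative `F = P` is needed because a graph without deficient vertices is output without a
validity test. -/
theorem Recurse.spec {P : Marked V} {out : List (Marked V)} (h : Recurse L P out) :
    ∀ F ∈ out, P.Le F ∧ (∀ v, ¬ F.Deficient v) ∧ (F = P ∨ F.Valid L) := by
  induction h with
  | done P h =>
    intro F hF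
    obtain rfl := List.mem_singleton.1 hF
    exact ⟨Le.refl _, h, .inl rfl⟩
  | complete P h ht out hd ho =>
    intro F hF
    obtain ⟨M, hM, hcov, rfl, hval⟩ := (ho F).1 hF
    refine ⟨le_connect _ _, fun v hv => ?_, .inr hval⟩
    obtain ⟨e, he, hve⟩ := hcov v (deficient_of_connect hM hv)
    exact not_deficient_connect hM he hve hv
  | branch P ht R hR out ho ih =>
    intro F hF
    obtain ⟨Q, hQ, hFQ⟩ := List.mem_flatMap.1 hF
    obtain ⟨O, -, hR, -⟩ := hR
    obtain ⟨M, -, -, -, rfl, hval⟩ := hR Q hQ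
    obtain ⟨h1, h2, h3⟩ := ih _ hQ F hFQ
    exact ⟨(le_connect _ _).trans h1, h2, .inr (h3.elim (fun h => h ▸ hval) id)⟩

theorem Valid.isPartial {P : Marked V} (h : P.Valid L) : P.IsPartial := h.1.1

/-- The edges of a child of `P` can be read off from `P` and any output of the child. -/
theorem IsOrbitConnection.edge_eq {O : Set V} {P Q F : Marked V} (h : IsOrbitConnection L O P Q)
    (hF : Q.Le F) (hF' : F.IsPartial) (e : Sym2 V) :
    ((∃ v ∈ e, v ∈ O) → Q.one.edge e = F.one.edge e) ∧
      ((¬ ∃ v ∈ e, v ∈ O) → Q.one.edge e = P.one.edge e) := by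
  obtain ⟨M, hM, hMO, hcov, rfl, hval⟩ := h
  constructor
  -- A vertex of `O` already has colour-1 degree 1 in the child, so no later step adds an edge at
  -- it.
  · rintro ⟨v, hve, hv⟩
    obtain ⟨e', he', hve'⟩ := hcov v hv
    have h1 := not_deficient_connect hM he' hve'
    rw [deficient_iff hval.isPartial.2] at h1
    have h2 := (isPartial_iff.1 hF').1 v
    exact hF.edge_eq (by omega) hve
  · intro hn
    refine connect_edge_of_notMem fun he => hn ?_
    obtain ⟨v, hv, hve⟩ := hMO e he
    exact ⟨v, hve, hv⟩

/-- The orbit `O` is invariant under `σ`. Edges of the children at `O` are those of the outputs, and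
all others are those of `P`; `σ` preserves both kinds. -/
theorem isIso_of_isOrbitConnection {P Q Q' F F' : Marked V} {O : Set V} {v : V}
    (hO : O = MulAction.orbit P.aut v) (hQ : IsOrbitConnection L O P Q)
    (hQ' : IsOrbitConnection L O P Q') (hF : Q.Le F) (hF' : Q'.Le F') (hFP : F.IsPartial)
    (hFP' : F'.IsPartial) {σ : Equiv.Perm V} (hσ : σ ∈ P.aut) (hσF : IsIso σ F F') :
    IsIso σ Q Q' := by
  have hσ' : P.comap σ = P := hσ
  have hmem : ∀ w, σ w ∈ O ↔ w ∈ O := by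
    intro w
    rw [hO]
    have h : MulAction.orbit P.aut (σ w) = MulAction.orbit P.aut w :=
      MulAction.orbit_smul (⟨σ, hσ⟩ : P.aut) w
    rw [← MulAction.orbit_eq_iff, ← MulAction.orbit_eq_iff, h]
  have hle : ∀ {Q}, IsOrbitConnection L O P Q → P.Le Q := by
    rintro _ ⟨M, -, -, -, rfl, -⟩
    exact le_connect _ _
  have hmap : ∀ e : Sym2 V, (∃ v ∈ e.map σ, v ∈ O) ↔ ∃ v ∈ e, v ∈ O := by
    intro e
    simp only [Sym2.mem_map, exists_exists_and_eq_and, hmem]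
  refine Marked.ext ?_ (Pregraph.ext (funext fun e => ?_) ?_)
  · show Q'.zero.comap σ = Q.zero
    rw [← (hle hQ).zero, ← (hle hQ').zero]
    exact congrArg Marked.zero hσ'
  · show Q'.one.edge (e.map σ) = Q.one.edge e
    by_cases he : ∃ v ∈ e, v ∈ O
    · rw [(hQ.edge_eq hF hFP e).1 he, (hQ'.edge_eq hF' hFP' (e.map σ)).1 ((hmap e).2 he)]
      exact congrArg (fun R => R.one.edge e) hσF
    · rw [(hQ.edge_eq hF hFP e).2 he, (hQ'.edge_eq hF' hFP' (e.map σ)).2 (mt (hmap e).1 he)]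
      exact congrArg (fun R => R.one.edge e) hσ'
  · show Q'.one.semi ∘ σ = Q.one.semi
    rw [← (hle hQ).semi, ← (hle hQ').semi]
    exact congrArg (fun R => R.one.semi) hσ'

/-- No automorphism of the input maps an output to a different one. -/
theorem Recurse.pairwise {P : Marked V} {out : List (Marked V)} (h : Recurse L P out) :
    out.Pairwise fun F F' => ∀ σ ∈ P.aut, ¬ IsIso σ F F' := by
  induction h with
  | done P h => exact List.pairwise_singleton _ _
  | complete P h ht out hd ho =>
    refine List.Pairwise.imp_of_mem ?_ hd
    intro F F' hF hF' hne σ hσ hiso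
    obtain ⟨M, hM, -, rfl, -⟩ := (ho F).1 hF
    obtain ⟨M', hM', -, rfl, -⟩ := (ho F').1 hF'
    refine hne ?_
    have hσ' : P.comap σ = P := hσ
    -- Added edges join deficient vertices, which `σ` fixes, so both outputs have the same added
    -- edges.
    have hfix : ∀ e : Sym2 V, (∀ v ∈ e, P.Deficient v) → e.map σ = e := fun e he =>
      (Sym2.map_congr fun v hv => ht σ hσ v (he v hv)).trans (congrFun Sym2.map_id' e)
    have hiff : ∀ e : Sym2 V, e.map σ ∈ M' ↔ e ∈ M := by
      intro e
      have h1 : P.one.edge (e.map σ) = P.one.edge e := congrArg (fun R => R.one.edge e) hσ'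
      have h2 : (P.connect M').one.edge (e.map σ) = (P.connect M).one.edge e :=
        congrArg (fun R => R.one.edge e) hiso
      by_cases he : e ∈ M <;> by_cases he' : e.map σ ∈ M'
      · simp [he, he']
      · rw [connect_edge_of_mem he, connect_edge_of_notMem he'] at h2; omega
      · rw [connect_edge_of_mem he', connect_edge_of_notMem he] at h2; omega
      · simp [he, he']
    congr 1
    ext e
    constructor
    · intro he
      rw [← hfix e (hM.1 e he).2]
      exact (hiff e).2 he
    · intro he
      rw [← hiff, hfix e (hM'.1 e he).2]
      exact he
  | branch P ht R hR out ho ih =>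
    obtain ⟨O, ⟨⟨v, hv, hO⟩, -⟩, hRO, hRp, -⟩ := hR
    have hpart : ∀ Q ∈ R, ∀ F ∈ out Q, Q.Le F ∧ F.IsPartial := by
      intro Q hQ F hF
      obtain ⟨h1, -, h3⟩ := (ho Q hQ).spec F hF
      obtain ⟨M, -, -, -, -, hval⟩ := hRO Q hQ
      exact ⟨h1, h3.elim (fun h => h ▸ hval.isPartial) Valid.isPartial⟩
    refine List.pairwise_flatMap.2 ⟨fun Q hQ => ?_, ?_⟩
    · refine List.Pairwise.imp_of_mem ?_ (ih Q hQ)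
      intro F F' hF hF' hne σ hσ hiso
      obtain ⟨h1, h2⟩ := hpart Q hQ F hF
      obtain ⟨h1', h2'⟩ := hpart Q hQ F' hF'
      -- Both outputs come from one child, so `σ` is an automorphism of that child and the induction
      -- hypothesis applies.
      exact hne σ (isIso_of_isOrbitConnection hO (hRO Q hQ) (hRO Q hQ) h1 h1' h2 h2' hσ hiso) hiso
    · refine List.Pairwise.imp_of_mem ?_ hRp
      intro Q Q' hQ hQ' hne F hF F' hF' σ hσ hiso
      obtain ⟨h1, h2⟩ := hpart Q hQ F hF
      obtain ⟨h1', h2'⟩ := hpart Q' hQ' F' hF'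
      exact hne ⟨σ, isIso_of_isOrbitConnection hO (hRO Q hQ) (hRO Q' hQ') h1 h1' h2 h2' hσ hiso⟩

/-! ### Completeness -/

/-- In a component of `P` without deficient vertices all edges of `Q` are present, so it is closed
in the connected graph `Q` and is everything. -/
theorem valid_of_cut_le {P Q : Marked V} (hQ : Q.IsC4Marked) (hL : Q.HasBlockList L)
    (h1 : Q.cut.Le P) (h2 : P.Le Q) : P.Valid L := by
  refine ⟨hL.of_cut_le h1 h2, fun v => ?_⟩
  by_cases h : ∃ w ∈ P.under.component v, P.Deficient w
  · exact .inr h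
  · left
    push Not at h
    rw [Set.eq_univ_iff_forall]
    have hsub : Q.under.component v ⊆ P.under.component v := by
      refine Pregraph.component_subset (Pregraph.mem_component_self _ _) fun u hu w huw => ?_
      refine Pregraph.mem_component_of_edge_right hu ?_
      have h3 := h u hu
      rw [deficient_iff (h2.isPartial hQ.isPartial).2] at h3
      have h4 := (isC4Marked_iff.1 hQ).2.1 u
      have h5 := h2.edge_eq (v := u) (by omega) (Sym2.mem_mk_left u w)
      simpa only [under, h2.zero, h5] using huw
    exact fun w => hsub (hQ.1.preconnected v w)

/-- The edges that are missing in `P`. -/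
def missingEdges (P Q : Marked V) : Set (Sym2 V) := {e | P.one.edge e ≠ Q.one.edge e}

/-- Colour-1 degree 1 bounds all multiplicities of `Q` by 1, so the difference is a set of edges
rather than a multiset. -/
theorem Le.eq_connect {P Q : Marked V} (h : P.Le Q) (hQ : Q.IsC4Marked) :
    Q = P.connect (P.missingEdges Q) := by
  refine Marked.ext h.zero.symm (Pregraph.ext (funext fun e => ?_) h.semi.symm)
  by_cases he : e ∈ P.missingEdges Q
  · rw [connect_edge_of_mem he]
    have h1 : P.one.edge e ≠ Q.one.edge e := he
    have h2 := h.edge e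
    have h3 : Q.one.edge e ≤ 1 := by
      induction e using Sym2.ind with | _ u v
      rw [← (isC4Marked_iff.1 hQ).2.1 u]
      exact Pregraph.edge_le_deg _ _ _
    omega
  · rw [connect_edge_of_notMem he]
    exact (not_not.1 he).symm

/-- In `Q` every vertex has colour-1 degree 1: a loop would count twice, and two missing edges at
one vertex would give degree 2. A non-deficient vertex of `P` has no missing edge. -/
theorem Le.isConnectionSet {P Q : Marked V} (h : P.Le Q) (hQ : Q.IsC4Marked) :
    P.IsConnectionSet (P.missingEdges Q) := by
  classical
  have hdeg := (isC4Marked_iff.1 hQ).2.1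
  have hpos : ∀ e ∈ P.missingEdges Q, 0 < Q.one.edge e := fun e he =>
    Nat.zero_lt_of_lt (lt_of_le_of_ne (h.edge e) he)
  refine ⟨fun e he => ⟨fun hd => ?_, fun v hv => ?_⟩, fun e he e' he' v hv hv' => ?_⟩
  · induction e using Sym2.ind with | _ u v
    obtain rfl : u = v := hd
    have h1 := hdeg u
    have h2 := hpos _ he
    have h3 := Finset.single_le_sum (f := fun w => Q.one.edge s(u, w)) (fun _ _ => Nat.zero_le _)
      (Finset.mem_univ u)
    unfold Pregraph.deg at h1
    omega
  · rw [deficient_iff (h.isPartial hQ.isPartial).2]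
    by_contra hne
    exact he (h.edge_eq (by rw [hdeg]; omega) hv)
  · obtain ⟨w, rfl⟩ := hv
    obtain ⟨w', rfl⟩ := hv'
    by_contra hne
    have hw : w ≠ w' := fun h => hne (h ▸ rfl)
    have h1 := Pregraph.card_le_deg Q.one v {w, w'} (by
      simp only [Finset.mem_insert, Finset.mem_singleton]
      rintro u (rfl | rfl)
      exacts [hpos _ he, hpos _ he'])
    rw [Finset.card_pair hw, hdeg] at h1
    omega

theorem Le.exists_missingEdge {P Q : Marked V} (h : P.Le Q) (hQ : Q.IsC4Marked) {v : V}
    (hv : P.Deficient v) : ∃ e ∈ P.missingEdges Q, v ∈ e := by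
  by_contra hn
  push Not at hn
  have h1 := deg_connect_of_forall_notMem (P := P) hn
  rw [← h.eq_connect hQ, (isC4Marked_iff.1 hQ).2.1] at h1
  rw [deficient_iff (h.isPartial hQ.isPartial).2] at hv
  omega

/-- The inequalities `cut Q ≤ P ≤ Q` are the invariant of the recursion. The target `Q` is
quantified inside the induction because it is replaced by isomorphic copies. -/
theorem Recurse.exists_iso {P : Marked V} {out : List (Marked V)} (h : Recurse L P out) :
    ∀ Q : Marked V, Q.IsC4Marked → Q.HasBlockList L → Q.cut.Le P → P.Le Q →
      ∃ F ∈ out, F.Iso Q := by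
  induction h with
  | done P h =>
    intro Q hQ hL h1 h2
    refine ⟨P, List.mem_singleton_self P, ?_⟩
    have : P = Q := by
      refine Marked.ext h2.zero (Pregraph.ext (funext fun e => ?_) h2.semi)
      by_contra he
      induction e using Sym2.ind with | _ u v
      exact h u (((h2.isConnectionSet hQ).1 _ he).2 u (Sym2.mem_mk_left _ _))
    exact this ▸ Iso.refl P
  | complete P h ht out hd ho =>
    intro Q hQ hL h1 h2
    exact ⟨Q, (ho Q).2 ⟨_, h2.isConnectionSet hQ, fun v hv => h2.exists_missingEdge hQ hv,
      h2.eq_connect hQ, valid_of_cut_le hQ hL (cut_le Q) (Le.refl Q)⟩, Iso.refl Q⟩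
  | branch P ht R hR out ho ih =>
    intro Q hQ hL h1 h2
    obtain ⟨O, ⟨⟨v₀, hv₀, hO⟩, -⟩, -, -, hR⟩ := hR
    have hOd : ∀ v ∈ O, P.Deficient v := by
      rintro v hv
      rw [hO] at hv
      obtain ⟨⟨σ, hσ⟩, rfl⟩ := hv
      have hσ' : P.comap σ = P := hσ
      show P.under.deg (σ v₀) = 2
      rw [← Pregraph.deg_comap_equiv, ← under_comap, hσ']
      exact hv₀
    have hM := h2.isConnectionSet hQ
    set M := P.missingEdges Q with hMdef
    -- The connections prescribed by `Q` at the orbit.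
    let M' : Set (Sym2 V) := {e | e ∈ M ∧ ∃ v ∈ O, v ∈ e}
    have hle : (P.connect M').Le Q := by
      refine ⟨h2.zero, h2.semi, fun e => ?_⟩
      rw [h2.eq_connect hQ]
      by_cases he : e ∈ M'
      · rw [connect_edge_of_mem he, connect_edge_of_mem he.1]
      · rw [connect_edge_of_notMem he]
        exact (le_connect P _).edge e
    have hcut := h1.trans (le_connect P M')
    obtain ⟨R', hR', σ, hσ⟩ := hR (P.connect M') ⟨M',
      ⟨fun e he => hM.1 e he.1, fun e he e' he' => hM.2 e he.1 e' he'.1⟩,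
      fun e he => he.2, fun v hv => by
        obtain ⟨e, he, hve⟩ := h2.exists_missingEdge hQ (hOd v hv)
        exact ⟨e, ⟨he, v, hv, hve⟩, hve⟩, rfl, valid_of_cut_le hQ hL hcut hle⟩
    -- Only a representative `R'` of this child is kept, so `Q` is carried along the isomorphism `σ`
    -- to lie above `R'`.
    have hσ' : (P.connect M').comap σ.symm = R' := hσ.symm
    obtain ⟨F, hF, hFQ⟩ := ih R' hR' (Q.comap σ.symm) (isC4Marked_comap_equiv hQ _)
      (hL.comap_equiv _) (by rw [cut_comap, ← hσ']; exact hcut.comap _)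
      (by rw [← hσ']; exact hle.comap _)
    exact ⟨F, List.mem_flatMap.2 ⟨R', hR', hF⟩, hFQ.trans ⟨σ.symm, rfl⟩⟩

end Output

end Marked

namespace Marked

variable {V : Type*}

/-! ### Initial marked pregraphs -/

theorem exists_isInitial {L : BlockList} {n : ℕ} (hn : L.order = n) :
    ∃ P : Marked (Fin n), P.IsInitial L := by
  have hcard : Fintype.card (Σ i : Fin L.length, Fin (L.get i).order) = n := by
    rw [← hn, BlockList.order, sum_map_eq, Fintype.card_sigma]
    simp
  let φ : (Σ i : Fin L.length, Fin (L.get i).order) ≃ Fin n := Fintype.equivFinOfCardEq hcard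
  let g : (Σ i : Fin L.length, Sym2 (Fin (L.get i).order)) → Sym2 (Fin n) :=
    fun p => p.2.map fun x => φ ⟨p.1, x⟩
  have hφ : ∀ i, Function.Injective fun x : Fin (L.get i).order => φ ⟨i, x⟩ := by
    intro i x y h
    simpa using h
  have hg : Function.Injective g := by
    rintro ⟨i, e⟩ ⟨j, e'⟩ h
    induction e using Sym2.ind with | _ x y
    have hx : φ ⟨i, x⟩ ∈ g ⟨j, e'⟩ := h ▸ Sym2.mem_mk_left _ _
    obtain ⟨z, -, hz⟩ := Sym2.mem_map.1 hx
    obtain rfl : j = i := congrArg Sigma.fst (φ.injective hz)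
    exact congrArg (Sigma.mk j) (Sym2.map.injective (hφ j) h)
  let H : (∀ i : Fin L.length, Pregraph (Fin (L.get i).order)) → Pregraph (Fin n) := fun K =>
    -- `g` lists the pairs inside one part; the default value 0 means that no edge joins different
    -- parts.
    { edge := Function.extend g (fun p => (K p.1).edge p.2) 0
      semi := fun v => (K (φ.symm v).1).semi (φ.symm v).2 }
  have hH : ∀ K i, (H K).comap (fun x => φ ⟨i, x⟩) = K i := by
    intro K i
    refine Pregraph.ext (funext fun e => ?_) (funext fun x => ?_)
    · exact hg.extend_apply (fun p => (K p.1).edge p.2) 0 ⟨i, e⟩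
    · show (K (φ.symm (φ ⟨i, x⟩)).1).semi (φ.symm (φ ⟨i, x⟩)).2 = (K i).semi x
      rw [φ.symm_apply_apply]
  have hH0 : ∀ K a b, a.1 ≠ b.1 → (H K).edge s(φ a, φ b) = 0 := by
    rintro K ⟨i, x⟩ ⟨j, y⟩ hab
    refine Function.extend_apply' (f := g) (fun p => (K p.1).edge p.2) 0 _ ?_
    rintro ⟨⟨k, e⟩, he⟩
    have hx : φ ⟨i, x⟩ ∈ g ⟨k, e⟩ := he ▸ Sym2.mem_mk_left _ _
    have hy : φ ⟨j, y⟩ ∈ g ⟨k, e⟩ := he ▸ Sym2.mem_mk_right _ _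
    obtain ⟨z, -, hz⟩ := Sym2.mem_map.1 hx
    obtain ⟨z', -, hz'⟩ := Sym2.mem_map.1 hy
    have h1 : k = i := congrArg Sigma.fst (φ.injective hz)
    have h2 : k = j := congrArg Sigma.fst (φ.injective hz')
    exact hab (h1.symm.trans h2)
  refine ⟨⟨H fun i => (L.get i).graph.zero, H fun i => (L.get i).graph.one⟩, φ,
    fun i => Marked.ext (hH (fun i => (L.get i).graph.zero) i)
      (hH (fun i => (L.get i).graph.one) i), fun a b hab => ?_⟩
  simp only [under, hH0 _ a b hab]

section Initial

variable [Fintype V] {L : BlockList} {P₀ : Marked V}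

/-- Without missing connections, the initial marked pregraph is a single block. -/
theorem IsInitial.valid_of_forall_not_deficient (h : P₀.IsInitial L) (hL : L.Acceptable)
    (hd : ∀ v, ¬ P₀.Deficient v) : P₀.Valid L := by
  obtain ⟨f, hf, hfg, hfc, hf'⟩ := h.exists_parts
  have hnum : ∀ i, (L.get i).numDeficient = 0 := by
    intro i
    unfold FinMarked.numDeficient
    rw [Set.ncard_eq_zero, Set.eq_empty_iff_forall_notMem, ← hfg]
    intro x hx
    exact hd (f i x) ((Pregraph.deg_comap (hf i) (hfc i) x).symm.trans hx)
  obtain ⟨G, hG, -, -, hdeg⟩ := hL.multigraphic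
  obtain ⟨i₀⟩ := hG.nonempty
  -- A connected multigraph with all degrees 0 has only one vertex, so `L` has only one entry.
  have hi : ∀ i, i = i₀ := by
    intro i
    have hr := (SimpleGraph.reachable_iff_reflTransGen _ _).1 (hG.preconnected i i₀)
    rcases hr.cases_head with h | ⟨c, hc, -⟩
    · exact h
    · have h1 := G.edge_le_deg i c
      rw [hdeg, hnum] at h1
      have h2 := hc.2
      omega
  have hrange : Set.range (f i₀) = Set.univ := by
    rw [Set.eq_univ_iff_forall]
    intro v
    obtain ⟨i, hv⟩ := hf' v
    exact hi i ▸ hv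
  obtain ⟨t, ht⟩ := IsInitial.isPreblock_range hL.isBlock hf hfg hfc i₀
  rw [hrange] at ht
  have hblock : ∀ S ∈ P₀.blockPartition, S = Set.univ := by
    intro S hS
    obtain ⟨t', ht'⟩ := isBlockSet_iff.1 hS
    obtain ⟨v, hv⟩ := ht'.prop.nonempty
    obtain rfl := (ht.hasType (Set.mem_univ v)).unique (ht'.prop.hasType hv)
    exact ht'.eq_of_subset ht (Set.subset_univ S)
  have huniv : Set.univ ∈ P₀.blockPartition :=
    isBlockSet_iff.2 ⟨t, ht, fun _ _ _ => Set.subset_univ _⟩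
  refine ⟨⟨h.isPartial hL.isBlock, Equiv.ofBijective (fun _ => ⟨Set.univ, huniv⟩)
    ⟨fun i j _ => (hi i).trans (hi j).symm, fun S => ⟨i₀, Subtype.ext (hblock _ S.2).symm⟩⟩,
    fun i => ?_⟩, fun v => .inl ?_⟩
  · obtain rfl := hi i
    rw [← hfg]
    exact ⟨(Equiv.ofBijective _ ⟨hf i, Set.range_eq_univ.1 hrange⟩).trans
      (Equiv.Set.univ V).symm, comap_comap _ _ _⟩
  · exact Set.univ_subset_iff.1 (component_of_connected_induce ht.connected (Set.mem_univ v))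

/-- Without deficient vertices, validity says that every component is everything. Nonemptiness comes
from the list: a connected multigraph realising its degrees has a vertex, so there is a block. -/
theorem isC4Marked_of_valid (hL : L.Acceptable) {P : Marked V} (h : P.Valid L)
    (hd : ∀ v, ¬ P.Deficient v) : P.IsC4Marked := by
  have hP := h.isPartial
  refine ⟨(SimpleGraph.connected_iff _).2 ⟨fun u v => ?_, ?_⟩,
    fun v => (hP.1 v).resolve_left (hd v), hP.2⟩
  · have hu := (h.2 u).resolve_right fun ⟨w, _, hw⟩ => hd w hw
    exact (hu ▸ Set.mem_univ v : v ∈ P.under.component u)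
  · obtain ⟨G, hG, -⟩ := hL.multigraphic
    obtain ⟨i₀⟩ := hG.nonempty
    obtain ⟨e, -⟩ := h.1.2
    obtain ⟨t, ht⟩ := isBlockSet_iff.1 (e i₀).2
    obtain ⟨v, -⟩ := ht.prop.nonempty
    exact ⟨v⟩

/-- The outputs for an acceptable list `L` have block list `L`, and the initial marked pregraph is
obtained from each of them by removing the edges between different blocks. -/
theorem Recurse.valid (h : P₀.IsInitial L) (hL : L.Acceptable) {out : List (Marked V)}
    (hout : Recurse L P₀ out) {F : Marked V} (hF : F ∈ out) :
    F.IsC4Marked ∧ F.HasBlockList L ∧ P₀ = F.cut := by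
  obtain ⟨h1, h2, h3⟩ := hout.spec F hF
  have hval : F.Valid L := by
    rcases h3 with rfl | h3
    exacts [h.valid_of_forall_not_deficient hL h2, h3]
  exact ⟨isC4Marked_of_valid hL hval h2, hval.1, h.eq_cut hL.isBlock h1 hval.1⟩

end Initial

end Marked

/-! ### Block lists of a given order -/

theorem FinMarked.IsBlock.order_pos {b : FinMarked} (h : b.IsBlock) : 1 ≤ b.order := by
  obtain ⟨t, ht⟩ := Marked.isBlockSet_iff.1 h.2
  obtain ⟨v, -⟩ := ht.prop.nonempty
  exact Fin.pos v

theorem Pregraph.semi_le_deg {V : Type*} [Fintype V] (G : Pregraph V) (v : V) :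
    G.semi v ≤ G.deg v := by
  unfold deg; omega

/-- Degrees are at most 3, so all multiplicities are below 4 and finitely many functions encode the
blocks of bounded order. -/
theorem FinMarked.finite_isBlock (n : ℕ) : {b : FinMarked | b.IsBlock ∧ b.order ≤ n}.Finite := by
  let g : (Σ k : Fin (n + 1), ((Sym2 (Fin k) → Fin 4) × (Fin k → Fin 4)) ×
      ((Sym2 (Fin k) → Fin 4) × (Fin k → Fin 4))) → FinMarked := fun p =>
    ⟨p.1, ⟨fun e => p.2.1.1 e, fun v => p.2.1.2 v⟩, ⟨fun e => p.2.2.1 e, fun v => p.2.2.2 v⟩⟩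
  refine (Set.finite_range g).subset ?_
  rintro ⟨k, P⟩ ⟨hb, hk⟩
  have hdeg : ∀ v, P.under.deg v ≤ 3 := hb.1.deg_le
  have hedge : ∀ e, P.under.edge e < 4 := by
    intro e
    induction e using Sym2.ind with | _ u v
    exact Nat.lt_succ_of_le ((Pregraph.edge_le_deg _ u v).trans (hdeg u))
  have hsemi : ∀ v, P.under.semi v < 4 := fun v =>
    Nat.lt_succ_of_le ((Pregraph.semi_le_deg _ v).trans (hdeg v))
  exact ⟨⟨⟨k, Nat.lt_succ_of_le hk⟩,
    (fun e => ⟨P.zero.edge e, (Nat.le_add_right _ _).trans_lt (hedge e)⟩,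
      fun v => ⟨P.zero.semi v, (Nat.le_add_right _ _).trans_lt (hsemi v)⟩),
    (fun e => ⟨P.one.edge e, (Nat.le_add_left _ _).trans_lt (hedge e)⟩,
      fun v => ⟨P.one.semi v, (Nat.le_add_left _ _).trans_lt (hsemi v)⟩)⟩, rfl⟩

theorem BlockList.Equiv.refl (L : BlockList) : L.Equiv L :=
  ⟨_root_.Equiv.refl _, fun _ => Marked.Iso.refl _⟩

theorem exists_generatesBlockLists (n : ℕ) : ∃ lists, GeneratesBlockLists n lists := by
  have hfin : {L : BlockList | L.Acceptable ∧ L.order = n}.Finite := by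
    have := (FinMarked.finite_isBlock n).to_subtype
    refine ((List.finite_length_le {b : FinMarked | b.IsBlock ∧ b.order ≤ n} n).image
      (List.map Subtype.val)).subset ?_
    rintro L ⟨hL, rfl⟩
    have hmem : ∀ b ∈ L, b ∈ {b : FinMarked | b.IsBlock ∧ b.order ≤ BlockList.order L} := fun b hb =>
      ⟨hL.isBlock b hb, List.le_sum_of_mem (List.mem_map_of_mem hb)⟩
    refine ⟨L.pmap Subtype.mk hmem, ?_, by simp [List.map_pmap]⟩
    -- Blocks are nonempty, so the length of a list is bounded by its order.
    have h1 := List.length_le_sum_of_one_le (L.map FinMarked.order) (by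
      intro k hk
      obtain ⟨b, hb, rfl⟩ := List.mem_map.1 hk
      exact (hL.isBlock b hb).order_pos)
    show (L.pmap Subtype.mk hmem).length ≤ BlockList.order L
    rw [List.length_pmap]
    simpa [BlockList.order] using h1
  obtain ⟨lists, h1, h2, h3⟩ := Marked.exists_representatives hfin BlockList.Equiv
    BlockList.Equiv.refl
  exact ⟨lists, h1, h2, fun L hL hn => h3 L ⟨hL, hn⟩⟩

/-! ### The theorem -/

theorem exists_generates (n : ℕ) : ∃ out, Generates n out := by
  obtain ⟨lists, hlists⟩ := exists_generatesBlockLists n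
  have hstart : ∀ L, ∃ P : Marked (Fin n), L ∈ lists → P.IsInitial L := fun L => by
    by_cases hL : L ∈ lists
    · obtain ⟨P, hP⟩ := Marked.exists_isInitial (hlists.1 L hL).2
      exact ⟨P, fun _ => hP⟩
    · exact ⟨⟨⟨0, 0⟩, ⟨0, 0⟩⟩, fun h => absurd h hL⟩
  choose start hstart using hstart
  choose res hres using fun L => Marked.exists_recurse (L := L) (start L)
  exact ⟨_, lists, hlists, start, res, fun L hL => ⟨hstart L hL, hres L⟩, rfl⟩

section Generates

variable {n : ℕ} {out : List (Marked (Fin n))}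

theorem Generates.isC4Marked (h : Generates n out) : ∀ P ∈ out, P.IsC4Marked := by
  obtain ⟨lists, hlists, start, res, hres, rfl⟩ := h
  intro P hP
  obtain ⟨L, hL, hP⟩ := List.mem_flatMap.1 hP
  exact ((hres L hL).2.valid (hres L hL).1 (hlists.1 L hL).1 hP).1

/-- For one list, both outputs have the starting graph as cut, so an isomorphism between them is an
automorphism of it. For different lists, block lists are isomorphism invariants. -/
theorem Generates.pairwise (h : Generates n out) : out.Pairwise fun P P' => ¬ P.Iso P' := by
  obtain ⟨lists, hlists, start, res, hres, rfl⟩ := h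
  have hval := fun {L} (hL : L ∈ lists) {F} (hF : F ∈ res L) =>
    (hres L hL).2.valid (hres L hL).1 (hlists.1 L hL).1 hF
  refine List.pairwise_flatMap.2 ⟨fun L hL => ?_, ?_⟩
  · refine List.Pairwise.imp_of_mem ?_ (hres L hL).2.pairwise
    rintro F F' hF hF' hne ⟨σ, hσ⟩
    refine hne σ ?_ hσ
    have h1 := hσ.cut
    rw [← (hval hL hF).2.2, ← (hval hL hF').2.2] at h1
    exact h1
  · refine List.Pairwise.imp_of_mem ?_ hlists.2.1
    intro L L' hL hL' hne F hF F' hF' hiso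
    exact hne ((hval hL hF).2.1.equiv_of_iso (hval hL' hF').2.1 hiso)

theorem Generates.exists_iso (h : Generates n out) {V : Type*} [Fintype V] {Q : Marked V}
    (hn : Fintype.card V = n) (hQ : Q.IsC4Marked) : ∃ F ∈ out, F.Iso Q := by
  obtain ⟨lists, hlists, start, res, hres, rfl⟩ := h
  obtain ⟨L', hL'⟩ := hQ.isPartial.exists_hasBlockList
  obtain ⟨hacc, hord⟩ := hL'.acceptable hQ
  obtain ⟨L, hL, hLL'⟩ := hlists.2.2 L' hacc (hord.trans hn)
  have hQL := hL'.of_equiv hLL'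
  obtain ⟨σ, hσ⟩ := (hres L hL).1.iso_cut hQL
  -- Rename the vertices of `Q` so that its cut is exactly the starting graph; the recursion's
  -- invariant then holds at the root.
  have hcut : (Q.comap σ).cut = start L := by
    rw [Marked.cut_comap]; exact hσ
  obtain ⟨F, hF, hFQ⟩ := (hres L hL).2.exists_iso (Q.comap σ) (Marked.isC4Marked_comap_equiv hQ σ)
    (hQL.comap_equiv σ) (hcut ▸ Marked.Le.refl _) (hcut ▸ Marked.cut_le _)
  exact ⟨F, List.mem_flatMap.2 ⟨L, hL, hF⟩, hFQ.trans ⟨σ, rfl⟩⟩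

end Generates

theorem mainTheorem2 (n : ℕ) :
    (∃ out, Generates n out) ∧
    (∀ L : BlockList, WellFounded (Marked.Calls (V := Fin n) L)) ∧
    ∀ out, Generates n out →
      (∀ P ∈ out, P.IsC4Marked) ∧
      ∀ (V : Type*) [Fintype V] (Q : Marked V), Fintype.card V = n → Q.IsC4Marked →
        ∃! i : Fin out.length, (out.get i).Iso Q := by
  refine ⟨exists_generates n, fun L => Marked.wellFounded_calls, fun out hout =>
    ⟨hout.isC4Marked, fun V _ Q hn hQ => ?_⟩⟩
  obtain ⟨F, hF, hFQ⟩ := hout.exists_iso hn hQ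
  obtain ⟨i, rfl⟩ := List.get_of_mem hF
  have hp := List.pairwise_iff_get.1 hout.pairwise
  refine ⟨i, hFQ, fun j hj => ?_⟩
  rcases lt_trichotomy i j with h | h | h
  · exact absurd (hFQ.trans hj.symm) (hp i j h)
  · exact h.symm
  · exact absurd (Marked.Iso.trans hj hFQ.symm) (hp j i h)
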